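/- Let $\sigma_0=I,\sigma_1,\sigma_2,\sigma_3$ be the Pauli matrices. For a linear map $\Phi$ on complex $2\times2$ matrices let $R_\Phi$ be the $4\times4$ matrix $(R_\Phi)_{ij}=\frac12\mathrm{Tr}\big(\sigma_i\Phi(\sigma_j)\big)$, i.e. (up to the layout and normalization that make $R_\Phi$ act on Bloch vectors by $(1,x')^T=R_\Phi(1,x)^T$) the matrix $\mathrm{Tr}\big(\rho_\Phi^{T_1}\,\sigma_i\otimes\sigma_j\big)$ of the partial transpose of the dual state $\rho_\Phi=(I\otimes\Phi)(|I\rangle\langle I|)$, $|I\rangle=\sum_i|ii\rangle$. A matrix $N$ is called a SLOCC normal form of $\Phi$ if there are $A,B\in SL(2,\mathbb C)$, a constant $c>0$ and a linear map $\Omega$ with $R_\Omega=cN$ and $\Phi(\rho)=B\,\Omega(A\rho A^\dagger)\,B^\dagger$ for all $\rho$. **Theorem 8 (SLOCC normal forms of qubit channels).** Let $\Phi$ be a trace-preserving completely positive map on one qubit. Then $\Phi$ has exactly one SLOCC normal form among the matrices $$\begin{pmatrix}1&0&0&0\\0&s_1&0&0\\0&0&s_2&0\\0&0&0&s_3\end{pmatrix},\qquad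 \begin{pmatrix}1&0&0&0\\0&x/\sqrt3&0&0\\0&0&x/\sqrt3&0\\2/3&0&0&1/3\end{pmatrix},\qquad \begin{pmatrix}1&0&0&0\\0&0&0&0\\0&0&0&0\\1&0&0&0\end{pmatrix},$$ where $1\ge s_1\ge s_2\ge|s_3|$, $1-s_1-s_2+s_3\ge0$ and $0\le x\le1$ (so both the kind and the parameters are unique). Moreover: 1. If the normal form is of the first kind, there are invertible complex $2\times2$ matrices $A,B$ such that $\Phi$ has the Kraus operators $p_iA\sigma_iB$ ($i=0,1,2,3$), where $p_i\ge0$ and $p_0^2=\frac{1+s_1+s_2+s_3}4$, $p_1^2=\frac{1+s_1-s_2-s_3}4$, $p_2^2=\frac{1-s_1+s_2-s_3}4$, $p_3^2=\frac{1-s_1-s_2+s_3}4$. 2. If it is of the second kind, there are invertible complex $2\times2$ matrices $A,B$ such that $\Phi$ has the Kraus operators $$\sqrt{\tfrac{1+x}2}\,A\begin{pmatrix}1&0\\0&\frac1{\sqrt3}\end{pmatrix}B,\qquad \sqrt{\tfrac{1-x}2}\,A\begin{pmatrix}1&0\\0&-\frac1{\sqrt3}\end{pmatrix}B,\qquad \sqrt{\tfrac23}\,A\begin{pmatrix}0&1\\0&0\end{pmatrix}B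 .$$ 3. If it is of the third kind, $\Phi$ is trivial: there is a density matrix $\tau$ with $\Phi(\rho)=\mathrm{Tr}(\rho)\,\tau$ for all $\rho$. 4. All these data are obtained from a Lorentz singular value decomposition: there are $c>0$, proper orthochronous Lorentz transformations $L_1,L_2$ and a matrix $N$ from the above list with $R_\Phi=c\,L_1NL_2$; and for every such decomposition there are $A,B\in SL(2,\mathbb C)$ whose Lorentz transformations $\frac12\mathrm{Tr}(\sigma_iA\sigma_jA^\dagger)$ and $\frac12\mathrm{Tr}(\sigma_iB\sigma_jB^\dagger)$ are $L_2$ and $L_1$, such that $\Phi(\rho)=B\,\Omega(A\rho A^\dagger)\,B^\dagger$ with $R_\Omega=cN$, and such that, for $N$ of the first or second kind, $\Phi$ has the Kraus operators of 1 or 2 with $(A,B)$ there replaced by $(\sqrt c\,B,A)$. -/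

import Mathlib

open scoped Matrix Kronecker ComplexOrder

/-- Complex `2 × 2` matrices: the operators of one qubit. -/
abbrev QubitOp : Type := Matrix (Fin 2) (Fin 2) ℂ

/-- Linear maps on the operators of one qubit. -/
abbrev QubitMap : Type := QubitOp →ₗ[ℂ] QubitOp

/-- The map `I ⊗ Φ` on operators of a bipartite system, the second party being the qubit. -/
def idTensor {ι : Type*} (Φ : QubitMap) (M : Matrix (ι × Fin 2) (ι × Fin 2) ℂ) :
    Matrix (ι × Fin 2) (ι × Fin 2) ℂ :=
  Matrix.of fun a b => Φ (Matrix.of fun k l => M (a.1, k) (b.1, l)) a.2 b.2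

/-- Complete positivity: `I_m ⊗ Φ` is positive for all `m`. -/
def IsCompletelyPositive (Φ : QubitMap) : Prop :=
  ∀ (m : ℕ) (M : Matrix (Fin m × Fin 2) (Fin m × Fin 2) ℂ),
    M.PosSemidef → (idTensor Φ M).PosSemidef

/-- Preservation of the trace. -/
def IsTracePreserving (Φ : QubitMap) : Prop :=
  ∀ X : QubitOp, (Φ X).trace = X.trace

/-- Trace-preserving completely positive maps on one qubit. -/
structure IsQubitChannel (Φ : QubitMap) : Prop where
  completelyPositive : IsCompletelyPositive Φ
  tracePreserving : IsTracePreserving Φ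

/-- The Pauli matrices `σ₀ = I, σ₁, σ₂, σ₃`. -/
def pauli : Fin 4 → QubitOp :=
  ![!![1, 0; 0, 1], !![0, 1; 1, 0], !![0, -Complex.I; Complex.I, 0], !![1, 0; 0, -1]]

/-- The unnormalized maximally entangled vector `|I⟩ = ∑ᵢ |i⟩|i⟩`. -/
def maxEntangled : Fin 2 × Fin 2 → ℂ := fun a => if a.1 = a.2 then 1 else 0

/-- The dual state `ρ_Φ = (I ⊗ Φ)(|I⟩⟨I|)`. -/
def dualState (Φ : QubitMap) : Matrix (Fin 2 × Fin 2) (Fin 2 × Fin 2) ℂ :=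
  idTensor Φ (Matrix.vecMulVec maxEntangled (star maxEntangled))

/-- Partial transposition with respect to the first subsystem. -/
def partialTranspose (M : Matrix (Fin 2 × Fin 2) (Fin 2 × Fin 2) ℂ) :
    Matrix (Fin 2 × Fin 2) (Fin 2 × Fin 2) ℂ :=
  Matrix.of fun a b => M (b.1, a.2) (a.1, b.2)

/-- The `R`-picture of a two-qubit operator: `R i j = Tr (ρ (σᵢ ⊗ σⱼ))`. -/
def rPicture (M : Matrix (Fin 2 × Fin 2) (Fin 2 × Fin 2) ℂ) : Matrix (Fin 4) (Fin 4) ℂ :=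
  Matrix.of fun i j => (M * (pauli i ⊗ₖ pauli j)).trace

/-- The matrix `R_Φ`: the `R`-picture of the partial transpose of the dual state, laid out and
normalized such that it acts on Bloch vectors by `(1, x') = R_Φ (1, x)`: columns belong to the
input, and the first row of a trace-preserving map is `(1, 0, 0, 0)`. -/
noncomputable def rMatrix (Φ : QubitMap) : Matrix (Fin 4) (Fin 4) ℂ :=
  (1 / 2 : ℂ) • (rPicture (partialTranspose (dualState Φ)))ᵀ

/-- The matrix `R_Φ` in terms of the action of `Φ` on Pauli matrices. -/
theorem rMatrix_apply (Φ : QubitMap) (i j : Fin 4) :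
    rMatrix Φ i j = (1 / 2 : ℂ) * (pauli i * Φ (pauli j)).trace := by
  have key : ∀ X : QubitOp, X = X 0 0 • Matrix.single 0 0 (1 : ℂ) + X 0 1 • Matrix.single 0 1 1
      + X 1 0 • Matrix.single 1 0 1 + X 1 1 • Matrix.single 1 1 1 := by
    intro X
    ext a b
    fin_cases a <;> fin_cases b <;> simp
  have hs : ∀ a b : Fin 2, (Matrix.of fun k l : Fin 2 =>
      Matrix.vecMulVec maxEntangled (star maxEntangled) (a, k) (b, l))
      = Matrix.single a b (1 : ℂ) := by
    intro a b
    ext k l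
    fin_cases a <;> fin_cases b <;> fin_cases k <;> fin_cases l <;>
      simp [maxEntangled, Matrix.vecMulVec]
  rw [key (pauli j)]
  simp only [map_add, map_smul, rMatrix, rPicture, partialTranspose, dualState, idTensor,
    Matrix.smul_apply, Matrix.transpose_apply, Matrix.of_apply, hs]
  simp [Matrix.trace, Matrix.mul_apply, Fintype.sum_prod_type]
  ring

/-- `Ω` is obtained from `Φ` by undoing the filtering operations `A`, `B`:
`Φ(ρ) = B Ω(A ρ A†) B†`. -/
def IsFiltering (Φ Ω : QubitMap) (A B : Matrix.SpecialLinearGroup (Fin 2) ℂ) : Prop :=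
  ∀ X : QubitOp, Φ X = B.val * Ω (A.val * X * A.valᴴ) * B.valᴴ

/-- `Φ` is related by the filtering operations `A`, `B` to the map with `R`-matrix `c N`. -/
def HasNormalFormVia (Φ : QubitMap) (N : Matrix (Fin 4) (Fin 4) ℝ) (c : ℝ)
    (A B : Matrix.SpecialLinearGroup (Fin 2) ℂ) : Prop :=
  ∃ Ω : QubitMap, rMatrix Ω = (c • N).map Complex.ofReal ∧ IsFiltering Φ Ω A B

/-- Filtering brings `Φ` to a map whose `R`-matrix is proportional to `N`. -/
def HasNormalForm (Φ : QubitMap) (N : Matrix (Fin 4) (Fin 4) ℝ) : Prop :=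
  ∃ c : ℝ, 0 < c ∧ ∃ A B : Matrix.SpecialLinearGroup (Fin 2) ℂ, HasNormalFormVia Φ N c A B

/-- The diagonal (unital) normal form. -/
def diagForm (s₁ s₂ s₃ : ℝ) : Matrix (Fin 4) (Fin 4) ℝ :=
  !![1, 0, 0, 0; 0, s₁, 0, 0; 0, 0, s₂, 0; 0, 0, 0, s₃]

/-- The allowed parameters of the diagonal normal form. -/
def DiagParams (s₁ s₂ s₃ : ℝ) : Prop :=
  s₁ ≤ 1 ∧ s₂ ≤ s₁ ∧ |s₃| ≤ s₂ ∧ 0 ≤ 1 - s₁ - s₂ + s₃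

/-- The non-diagonalizable normal form. -/
noncomputable def nonDiagForm (x : ℝ) : Matrix (Fin 4) (Fin 4) ℝ :=
  !![1, 0, 0, 0; 0, x / √3, 0, 0; 0, 0, x / √3, 0; 2 / 3, 0, 0, 1 / 3]

/-- The normal form of the trivial maps. -/
def constForm : Matrix (Fin 4) (Fin 4) ℝ :=
  !![1, 0, 0, 0; 0, 0, 0, 0; 0, 0, 0, 0; 1, 0, 0, 0]

/-- The list of normal forms. -/
def IsNormalForm (N : Matrix (Fin 4) (Fin 4) ℝ) : Prop :=
  (∃ s₁ s₂ s₃ : ℝ, DiagParams s₁ s₂ s₃ ∧ N = diagForm s₁ s₂ s₃) ∨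
  (∃ x : ℝ, 0 ≤ x ∧ x ≤ 1 ∧ N = nonDiagForm x) ∨
  N = constForm

/-- `(K i)` is a family of Kraus operators of `Φ`. -/
def IsKrausFamily {ι : Type*} [Fintype ι] (K : ι → QubitOp) (Φ : QubitMap) : Prop :=
  ∀ X : QubitOp, Φ X = ∑ i, K i * X * (K i)ᴴ

/-- The eigenvalues of the normalized dual state (a Bell-diagonal state) of the map with
`R`-matrix `diag(1, s₁, s₂, s₃)`; the `i`-th one belongs to the eigenvector given by `σᵢ`. -/
noncomputable def bellEigenvalue (s₁ s₂ s₃ : ℝ) : Fin 4 → ℝ :=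
  ![(1 + s₁ + s₂ + s₃) / 4, (1 + s₁ - s₂ - s₃) / 4,
    (1 - s₁ + s₂ - s₃) / 4, (1 - s₁ - s₂ + s₃) / 4]

/-- The coefficients `p i ≥ 0` with `(p i)² = ` the `i`-th eigenvalue. -/
def IsBellCoeff (p : Fin 4 → ℝ) (s₁ s₂ s₃ : ℝ) : Prop :=
  ∀ i, 0 ≤ p i ∧ p i ^ 2 = bellEigenvalue s₁ s₂ s₃ i

/-- The operators `pᵢ A σᵢ B`. -/
noncomputable def diagKraus (p : Fin 4 → ℝ) (A B : QubitOp) : Fin 4 → QubitOp :=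
  fun i => (p i : ℂ) • (A * pauli i * B)

/-- The Kraus operators belonging to the non-diagonalizable normal form. -/
noncomputable def nonDiagKraus (x : ℝ) (A B : QubitOp) : Fin 3 → QubitOp :=
  ![((√((1 + x) / 2) : ℝ) : ℂ) • (A * !![1, 0; 0, ((1 / √3 : ℝ) : ℂ)] * B),
    ((√((1 - x) / 2) : ℝ) : ℂ) • (A * !![1, 0; 0, -((1 / √3 : ℝ) : ℂ)] * B),
    ((√(2 / 3) : ℝ) : ℂ) • (A * !![0, 1; 0, 0] * B)]

/-- The Minkowski metric `diag(1, -1, -1, -1)`. -/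
def minkowski : Matrix (Fin 4) (Fin 4) ℝ := Matrix.diagonal ![1, -1, -1, -1]

/-- Proper orthochronous Lorentz transformations. -/
def IsLorentz (L : Matrix (Fin 4) (Fin 4) ℝ) : Prop :=
  Lᵀ * minkowski * L = minkowski ∧ L.det = 1 ∧ 0 < L 0 0

/-- The Lorentz transformation `X ↦ A X A†` in Pauli coordinates. -/
noncomputable def lorentzOf (A : Matrix.SpecialLinearGroup (Fin 2) ℂ) :
    Matrix (Fin 4) (Fin 4) ℝ :=
  Matrix.of fun i j => (1 / 2) * (pauli i * (A.val * pauli j * A.valᴴ)).trace.re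

/-- `R_Φ = c L₁ N L₂` is a Lorentz singular value decomposition: `L₁`, `L₂` are proper
orthochronous Lorentz transformations, and `N` is one of the normal forms. -/
structure IsLorentzSVD (Φ : QubitMap) (c : ℝ) (L₁ N L₂ : Matrix (Fin 4) (Fin 4) ℝ) : Prop where
  pos : 0 < c
  left : IsLorentz L₁
  normal : IsNormalForm N
  right : IsLorentz L₂
  eq : rMatrix Φ = (c • (L₁ * N * L₂)).map Complex.ofReal

/-!
In Pauli coordinates a Hermitian matrix `∑ vᵢ σᵢ` has determinant `v₀² - v₁² - v₂² - v₃²`, so that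
`X ↦ A X A†` with `det A = 1` is a Lorentz transformation, and every proper orthochronous Lorentz
transformation arises in this way (`isLorentz_lorentzOf`, `exists_lorentzOf_eq`). Hence filtering
`Φ` by `A` and `B` amounts to multiplying `R_Φ` by Lorentz matrices (`hasNormalFormVia_iff`), and a
normal form of `Φ` is the same thing as a Lorentz singular value decomposition of `R_Φ`. Kraus
operators are checked on the normal forms themselves and transported along the filtering
(`HasNormalFormVia.isKrausFamily`).

*Uniqueness.* Up to a positive factor, the similarity class of `η Nᵀ η N` depends on the map only.
For the first kind this matrix is `diag(1, s₁², s₂², s₃²)`, for the second it has eigenvalues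
`1/3, 1/3, x²/3, x²/3` and a Jordan block for `1/3`, for the third it vanishes. In the first two
cases the largest eigenvalue fixes the factor, the others fix the parameters up to the sign of `s₃`,
and the determinant of `N` fixes that sign (`HasNormalForm.unique`).

*Existence.* Suppose first that no pure state is mapped to a pure state. Then `det Φ(X) > 0` for
all positive `X ≠ 0`, and `det X / det Φ(X)`, which is homogeneous of degree zero, attains a positive
maximum at an invertible matrix (`exists_maximizer`). After a filtering this is the identity and
is mapped to itself; the first-order condition then says that the traces of the images of the other
Pauli matrices vanish (`trace_map_pauli_eq_zero`). So `R` is `1 ⊕ T` with a `3 × 3` matrix `T`, and a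
singular value decomposition of `T` with proper rotations (`exists_rotations_diagonal`) gives the
first normal form; complete positivity restricts its parameters.

If some pure state is mapped to a pure state, unitary filtering makes both equal to `|0⟩⟨0|`.
Positivity of the dual state leaves
`Φ(|0⟩⟨1|) = μ |0⟩⟨1|` and `Φ(|1⟩⟨1|) = (β, ν; ν̄, δ)` with `|μ|² ≤ δ`. If `δ = 0`, the map is trivial.
Otherwise unipotent filtering operations, which fix `|0⟩⟨0|`, remove `ν`
(`exists_normalForm_of_fixed_pure`), and according to whether the new `β` is zero or positive,
diagonal filtering operations lead to the first or the second normal form.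
-/


/-! ### Pauli coordinates -/

theorem pauli_conjTranspose (i : Fin 4) : (pauli i)ᴴ = pauli i := by
  ext a b
  fin_cases i <;> fin_cases a <;> fin_cases b <;> simp [pauli]

theorem trace_pauli_mul_pauli (i j : Fin 4) :
    (pauli i * pauli j).trace = if i = j then 2 else 0 := by
  fin_cases i <;> fin_cases j <;> simp [pauli, Matrix.trace, Fin.sum_univ_two] <;> norm_num

theorem pauli_expansion (X : QubitOp) :
    X = ∑ i, ((1 / 2 : ℂ) * (pauli i * X).trace) • pauli i := by
  ext a b
  fin_cases a <;> fin_cases b <;>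
    simp [Fin.sum_univ_four, pauli, Matrix.trace, Matrix.mul_apply, Fin.sum_univ_two] <;>
    ring_nf <;> simp <;> ring

/-- The map `X ↦ A X A†`. -/
def conjMap (A : QubitOp) : QubitMap where
  toFun X := A * X * Aᴴ
  map_add' X Y := by simp [mul_add, add_mul]
  map_smul' c X := by simp

@[simp] theorem conjMap_apply (A X : QubitOp) : conjMap A X = A * X * Aᴴ := rfl

theorem conjMap_comp (A B : QubitOp) : conjMap A ∘ₗ conjMap B = conjMap (A * B) := by
  ext1 X
  simp [Matrix.mul_assoc, Matrix.conjTranspose_mul]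

theorem map_pauli (Φ : QubitMap) (j : Fin 4) : Φ (pauli j) = ∑ i, rMatrix Φ i j • pauli i := by
  simp only [rMatrix_apply]
  exact pauli_expansion _

theorem rMatrix_comp (Φ Ψ : QubitMap) : rMatrix (Φ ∘ₗ Ψ) = rMatrix Φ * rMatrix Ψ := by
  ext i j
  rw [rMatrix_apply, LinearMap.comp_apply, map_pauli Ψ, map_sum, Matrix.mul_sum, Matrix.trace_sum,
    Matrix.mul_apply, Finset.mul_sum]
  refine Finset.sum_congr rfl fun k _ => ?_
  rw [map_smul, Matrix.mul_smul, Matrix.trace_smul, rMatrix_apply Φ, smul_eq_mul]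
  ring

theorem rMatrix_injective : Function.Injective rMatrix := by
  intro Φ Ψ h
  ext1 X
  rw [pauli_expansion X]
  simp only [map_sum, map_smul]
  refine Finset.sum_congr rfl fun i _ => ?_
  rw [map_pauli, map_pauli, h]

theorem rMatrix_smul (c : ℂ) (Φ : QubitMap) : rMatrix (c • Φ) = c • rMatrix Φ := by
  ext i j
  simp only [rMatrix_apply, LinearMap.smul_apply, Matrix.smul_apply, Matrix.mul_smul,
    Matrix.trace_smul, smul_eq_mul]
  ring

/-- The linear map with a prescribed `R`-matrix. -/
noncomputable def mapOfRMatrix (R : Matrix (Fin 4) (Fin 4) ℂ) : QubitMap where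
  toFun X := ∑ i, ∑ j, ((1 / 2 : ℂ) * R i j * (pauli j * X).trace) • pauli i
  map_add' X Y := by
    simp only [mul_add, Matrix.trace_add, add_smul, Finset.sum_add_distrib]
  map_smul' c X := by
    simp only [Matrix.mul_smul, Matrix.trace_smul, smul_eq_mul, RingHom.id_apply, Finset.smul_sum,
      smul_smul]
    refine Finset.sum_congr rfl fun i _ => Finset.sum_congr rfl fun j _ => ?_
    congr 1
    ring

theorem mapOfRMatrix_apply (R : Matrix (Fin 4) (Fin 4) ℂ) (X : QubitOp) :
    mapOfRMatrix R X = ∑ i, ∑ j, ((1 / 2 : ℂ) * R i j * (pauli j * X).trace) • pauli i := rfl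

theorem rMatrix_mapOfRMatrix (R : Matrix (Fin 4) (Fin 4) ℂ) : rMatrix (mapOfRMatrix R) = R := by
  ext i j
  rw [rMatrix_apply, mapOfRMatrix_apply]
  simp only [Matrix.mul_sum, Matrix.mul_smul, Matrix.trace_sum, Matrix.trace_smul,
    trace_pauli_mul_pauli, smul_eq_mul]
  simp
  ring

theorem eq_mapOfRMatrix {Φ : QubitMap} {R : Matrix (Fin 4) (Fin 4) ℂ} (h : rMatrix Φ = R) :
    Φ = mapOfRMatrix R := rMatrix_injective (by rw [h, rMatrix_mapOfRMatrix])

/-! ### The Lorentz transformation of a matrix of determinant one -/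

theorem lorentzOf_map (A : Matrix.SpecialLinearGroup (Fin 2) ℂ) :
    (lorentzOf A).map Complex.ofReal = rMatrix (conjMap A.val) := by
  ext i j
  rw [rMatrix_apply, conjMap_apply, Matrix.map_apply, lorentzOf, Matrix.of_apply]
  have h : star (pauli i * (A.val * pauli j * A.valᴴ)).trace
      = (pauli i * (A.val * pauli j * A.valᴴ)).trace := by
    rw [← Matrix.trace_conjTranspose]
    simp only [Matrix.conjTranspose_mul, Matrix.conjTranspose_conjTranspose, pauli_conjTranspose]
    rw [Matrix.trace_mul_comm]
    simp only [Matrix.mul_assoc]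
  have h2 := Complex.conj_eq_iff_re.mp h
  rw [Complex.ofReal_mul, h2]
  norm_num

theorem ofReal_map_injective {m n : Type*} :
    Function.Injective fun M : Matrix m n ℝ => M.map Complex.ofReal :=
  Matrix.map_injective Complex.ofReal_injective

theorem map_ofReal_mul (M N : Matrix (Fin 4) (Fin 4) ℝ) :
    (M * N).map Complex.ofReal = M.map Complex.ofReal * N.map Complex.ofReal :=
  Matrix.map_mul (f := Complex.ofRealHom)

theorem map_ofReal_smul (c : ℝ) (N : Matrix (Fin 4) (Fin 4) ℝ) :
    (c • N).map Complex.ofReal = (c : ℂ) • N.map Complex.ofReal := by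
  ext i j
  simp

theorem lorentzOf_mul (A B : Matrix.SpecialLinearGroup (Fin 2) ℂ) :
    lorentzOf (A * B) = lorentzOf A * lorentzOf B := by
  apply ofReal_map_injective
  simp only [map_ofReal_mul, lorentzOf_map, ← rMatrix_comp, conjMap_comp,
    Matrix.SpecialLinearGroup.coe_mul]

theorem lorentzOf_one : lorentzOf 1 = 1 := by
  ext i j
  simp only [lorentzOf, Matrix.of_apply, Matrix.SpecialLinearGroup.coe_one, Matrix.one_mul,
    Matrix.conjTranspose_one, Matrix.mul_one, trace_pauli_mul_pauli, Matrix.one_apply]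
  split_ifs <;> simp

theorem lorentzOf_inv_mul (A : Matrix.SpecialLinearGroup (Fin 2) ℂ) :
    lorentzOf A⁻¹ * lorentzOf A = 1 := by
  rw [← lorentzOf_mul, inv_mul_cancel, lorentzOf_one]

theorem lorentzOf_mul_inv (A : Matrix.SpecialLinearGroup (Fin 2) ℂ) :
    lorentzOf A * lorentzOf A⁻¹ = 1 := by
  rw [← lorentzOf_mul, mul_inv_cancel, lorentzOf_one]

/-! ### Filtering operations -/

/-- The map `X ↦ B Φ(A X A†) B†`. -/
def filtered (A : QubitOp) (Φ : QubitMap) (B : QubitOp) : QubitMap :=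
  conjMap B ∘ₗ Φ ∘ₗ conjMap A

@[simp] theorem filtered_apply (A : QubitOp) (Φ : QubitMap) (B X : QubitOp) :
    filtered A Φ B X = B * Φ (A * X * Aᴴ) * Bᴴ := rfl

theorem filtered_filtered (A A' : QubitOp) (Φ : QubitMap) (B B' : QubitOp) :
    filtered A' (filtered A Φ B) B' = filtered (A * A') Φ (B' * B) := by
  ext1 X
  simp [Matrix.mul_assoc, Matrix.conjTranspose_mul]

theorem filtered_one (Φ : QubitMap) : filtered 1 Φ 1 = Φ := by
  ext1 X
  simp

theorem isFiltering_iff (Φ Ω : QubitMap) (A B : Matrix.SpecialLinearGroup (Fin 2) ℂ) :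
    IsFiltering Φ Ω A B ↔ Φ = filtered A.val Ω B.val :=
  ⟨fun h => LinearMap.ext h, fun h X => by rw [h]; rfl⟩

theorem rMatrix_filtered (Φ : QubitMap) (A B : Matrix.SpecialLinearGroup (Fin 2) ℂ) :
    rMatrix (filtered A.val Φ B.val)
      = (lorentzOf B).map Complex.ofReal * rMatrix Φ * (lorentzOf A).map Complex.ofReal := by
  rw [filtered, rMatrix_comp, rMatrix_comp, lorentzOf_map, lorentzOf_map, Matrix.mul_assoc]

theorem hasNormalFormVia_iff (Φ : QubitMap) (N : Matrix (Fin 4) (Fin 4) ℝ) (c : ℝ)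
    (A B : Matrix.SpecialLinearGroup (Fin 2) ℂ) :
    HasNormalFormVia Φ N c A B ↔
      rMatrix Φ = (c • (lorentzOf B * N * lorentzOf A)).map Complex.ofReal := by
  have h : (c • (lorentzOf B * N * lorentzOf A)).map Complex.ofReal
      = rMatrix (filtered A.val (mapOfRMatrix ((c • N).map Complex.ofReal)) B.val) := by
    rw [rMatrix_filtered, rMatrix_mapOfRMatrix, ← map_ofReal_mul, ← map_ofReal_mul,
      Matrix.mul_smul, Matrix.smul_mul]
  rw [h]
  constructor
  · rintro ⟨Ω, hΩ, hf⟩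
    rw [← eq_mapOfRMatrix hΩ, ← (isFiltering_iff _ _ _ _).1 hf]
  · intro hR
    exact ⟨_, rMatrix_mapOfRMatrix _, (isFiltering_iff _ _ _ _).2 (rMatrix_injective hR)⟩

/-- Every invertible matrix is a multiple of one of determinant one. -/
theorem exists_smul_specialLinear (A : QubitOp) (hA : A.det ≠ 0) :
    ∃ (l : ℂ) (S : Matrix.SpecialLinearGroup (Fin 2) ℂ), l ≠ 0 ∧ A = l • S.val := by
  obtain ⟨l, hl⟩ := IsAlgClosed.exists_pow_nat_eq A.det (n := 2) (by norm_num)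
  have hl0 : l ≠ 0 := by
    rintro rfl
    exact hA (by rw [← hl]; norm_num)
  refine ⟨l, ⟨l⁻¹ • A, ?_⟩, hl0, ?_⟩
  · rw [Matrix.det_smul, ← hl, Fintype.card_fin]
    field_simp
  · simp [smul_smul, hl0]

/-- Filtering by invertible matrices of arbitrary determinant preserves the normal forms: the
determinants only contribute to the positive constant. -/
theorem HasNormalForm.to_filtered {Φ : QubitMap} {N : Matrix (Fin 4) (Fin 4) ℝ}
    (h : HasNormalForm Φ N) {A B : QubitOp} (hA : A.det ≠ 0) (hB : B.det ≠ 0) :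
    HasNormalForm (filtered A Φ B) N := by
  obtain ⟨c, hc, A₀, B₀, hV⟩ := h
  obtain ⟨l, S, hl, rfl⟩ := exists_smul_specialLinear A hA
  obtain ⟨m, T, hm, rfl⟩ := exists_smul_specialLinear B hB
  have key : filtered (l • S.val) Φ (m • T.val)
      = ((Complex.normSq l * Complex.normSq m : ℝ) : ℂ) • filtered S.val Φ T.val := by
    ext1 X
    simp only [filtered_apply, LinearMap.smul_apply, Matrix.conjTranspose_smul, Matrix.smul_mul,
      Matrix.mul_smul, map_smul, smul_smul]
    congr 1
    push_cast
    rw [Complex.normSq_eq_conj_mul_self, Complex.normSq_eq_conj_mul_self]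
    simp only [RCLike.star_def]
    ring
  refine ⟨Complex.normSq l * Complex.normSq m * c,
    mul_pos (mul_pos (Complex.normSq_pos.2 hl) (Complex.normSq_pos.2 hm)) hc, A₀ * S, T * B₀, ?_⟩
  rw [hasNormalFormVia_iff] at hV ⊢
  rw [key, rMatrix_smul, rMatrix_filtered, hV, ← map_ofReal_mul, ← map_ofReal_mul,
    ← map_ofReal_smul, lorentzOf_mul, lorentzOf_mul]
  congr 1
  simp only [Matrix.mul_smul, Matrix.smul_mul, smul_smul, Matrix.mul_assoc]

theorem HasNormalForm.of_filtered {Φ : QubitMap} {N : Matrix (Fin 4) (Fin 4) ℝ} {A B : QubitOp}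
    (hA : A.det ≠ 0) (hB : B.det ≠ 0) (h : HasNormalForm (filtered A Φ B) N) :
    HasNormalForm Φ N := by
  have hA' : IsUnit A.det := hA.isUnit
  have hB' : IsUnit B.det := hB.isUnit
  have := h.to_filtered (A := A⁻¹) (B := B⁻¹) (by simp [Matrix.det_nonsing_inv, hA])
    (by simp [Matrix.det_nonsing_inv, hB])
  rwa [filtered_filtered, Matrix.mul_nonsing_inv _ hA', Matrix.nonsing_inv_mul _ hB',
    filtered_one] at this

/-! ### The spinor map onto the Lorentz group -/

theorem minkowski_preserved_mul {L M : Matrix (Fin 4) (Fin 4) ℝ}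
    (hL : Lᵀ * minkowski * L = minkowski)
    (hM : Mᵀ * minkowski * M = minkowski) : (L * M)ᵀ * minkowski * (L * M) = minkowski := by
  calc (L * M)ᵀ * minkowski * (L * M) = Mᵀ * (Lᵀ * minkowski * L) * M := by
        simp only [Matrix.transpose_mul, Matrix.mul_assoc]
    _ = minkowski := by rw [hL, hM]

theorem minkowski_mul_self : minkowski * minkowski = 1 := by
  rw [minkowski, Matrix.diagonal_mul_diagonal, ← Matrix.diagonal_one]
  congr 1
  ext i
  fin_cases i <;> simp

/-- The rows of a Lorentz matrix satisfy the same orthogonality relations as its columns. -/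
theorem mul_minkowski_mul_transpose {L : Matrix (Fin 4) (Fin 4) ℝ}
    (hL : Lᵀ * minkowski * L = minkowski) : L * minkowski * Lᵀ = minkowski := by
  have h1 : (minkowski * Lᵀ * minkowski) * L = 1 := by
    rw [Matrix.mul_assoc, Matrix.mul_assoc, ← Matrix.mul_assoc Lᵀ, hL, minkowski_mul_self]
  have h2 := mul_eq_one_comm.1 h1
  calc L * minkowski * Lᵀ = L * (minkowski * Lᵀ * minkowski) * minkowski := by
        simp only [Matrix.mul_assoc, minkowski_mul_self, Matrix.mul_one]
    _ = minkowski := by rw [h2, Matrix.one_mul]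

theorem trace_adjugate_pauli_mul_pauli (i j : Fin 4) :
    ((pauli i).adjugate * pauli j).trace = 2 * (minkowski i j : ℂ) := by
  fin_cases i <;> fin_cases j <;>
    simp [pauli, Matrix.adjugate_fin_two_of, Matrix.trace, Fin.sum_univ_two, minkowski] <;>
    norm_num

theorem adjugate_sum_smul (v : Fin 4 → ℂ) (P : Fin 4 → QubitOp) :
    (∑ k, v k • P k).adjugate = ∑ k, v k • (P k).adjugate := by
  ext a b
  fin_cases a <;> fin_cases b <;>
    simp [Matrix.adjugate_fin_two, Fin.sum_univ_four] <;> ring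

/-- The pairing `Tr (adj X · Y)`, the polar form of the determinant, is invariant under
`X ↦ A X A†` for `det A = 1`; in Pauli coordinates it is twice the Minkowski form. -/
theorem lorentzOf_minkowski (A : Matrix.SpecialLinearGroup (Fin 2) ℂ) :
    (lorentzOf A)ᵀ * minkowski * lorentzOf A = minkowski := by
  have hA : A.val.adjugate * A.val = 1 := by rw [Matrix.adjugate_mul, A.2, one_smul]
  have hA' : A.valᴴ * A.valᴴ.adjugate = 1 := by
    rw [Matrix.mul_adjugate, Matrix.det_conjTranspose, A.2, star_one, one_smul]
  ext i j
  apply Complex.ofReal_injective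
  have h1 : ((conjMap A.val (pauli i)).adjugate * conjMap A.val (pauli j)).trace
      = 2 * (minkowski i j : ℂ) := by
    rw [← trace_adjugate_pauli_mul_pauli, conjMap_apply, conjMap_apply,
      Matrix.adjugate_mul_distrib, Matrix.adjugate_mul_distrib]
    calc (A.valᴴ.adjugate * ((pauli i).adjugate * A.val.adjugate)
          * (A.val * pauli j * A.valᴴ)).trace
        = (A.valᴴ.adjugate * ((pauli i).adjugate * (A.val.adjugate * A.val) * pauli j)
            * A.valᴴ).trace := by simp only [Matrix.mul_assoc]
      _ = _ := by
        rw [hA, Matrix.trace_mul_comm, ← Matrix.mul_assoc, hA', Matrix.one_mul, Matrix.mul_one]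
  rw [map_pauli, map_pauli, adjugate_sum_smul, ← lorentzOf_map] at h1
  simp only [Matrix.sum_mul, Matrix.mul_sum, Matrix.trace_sum, Matrix.smul_mul, Matrix.mul_smul,
    Matrix.trace_smul, trace_adjugate_pauli_mul_pauli, Matrix.map_apply, smul_eq_mul] at h1
  have h2 : (2 : ℂ) * (((lorentzOf A)ᵀ * minkowski * lorentzOf A) i j : ℝ)
      = 2 * (minkowski i j : ℂ) := by
    rw [← h1]
    simp only [Matrix.mul_apply, Matrix.transpose_apply, Complex.ofReal_sum, Complex.ofReal_mul,
      Finset.mul_sum, Finset.sum_mul]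
    refine Finset.sum_congr rfl fun k _ => Finset.sum_congr rfl fun l _ => ?_
    ring
  exact mul_left_cancel₀ two_ne_zero h2

/-- The change of basis from Pauli coordinates to matrix entries. -/
def pauliBasis : Matrix (Fin 2 × Fin 2) (Fin 4) ℂ := Matrix.of fun a j => pauli j a.1 a.2

/-- In the basis of matrix units `X ↦ A X A†` is `A ⊗ Ā`, whose determinant is a product of powers
of `det A` and its conjugate. -/
theorem lorentzOf_det (A : Matrix.SpecialLinearGroup (Fin 2) ℂ) : (lorentzOf A).det = 1 := by
  apply Complex.ofReal_injective
  have e : ((lorentzOf A).det : ℂ) = (rMatrix (conjMap A.val)).det := by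
    rw [← lorentzOf_map]
    exact Complex.ofRealHom.map_det _
  rw [e]
  have h1 : pauliBasis * ((1 / 2 : ℂ) • pauliBasisᴴ) = 1 := by
    ext ⟨a, b⟩ ⟨c, d⟩
    fin_cases a <;> fin_cases b <;> fin_cases c <;> fin_cases d <;>
      simp [pauliBasis, Matrix.mul_apply, Fin.sum_univ_four, pauli] <;>
      ring_nf <;> norm_num
  have h2 : ((1 / 2 : ℂ) • pauliBasisᴴ) * pauliBasis = 1 := by
    ext i j
    fin_cases i <;> fin_cases j <;>
      simp [pauliBasis, Matrix.mul_apply, Fintype.sum_prod_type, pauli] <;>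
      ring_nf <;> norm_num
  have h3 : (A.val ⊗ₖ A.val.map star) * pauliBasis = pauliBasis * rMatrix (conjMap A.val) := by
    ext ⟨a, b⟩ j
    have := congrFun (congrFun (map_pauli (conjMap A.val) j) a) b
    simp only [conjMap_apply, Matrix.mul_apply, Matrix.sum_apply, Matrix.smul_apply,
      Matrix.conjTranspose_apply, Fin.sum_univ_two, Fin.sum_univ_four, smul_eq_mul] at this
    simp only [Matrix.mul_apply, pauliBasis, Matrix.of_apply, Matrix.kroneckerMap_apply,
      Fintype.sum_prod_type, Matrix.map_apply, Fin.sum_univ_two, Fin.sum_univ_four]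
    linear_combination this
  have h4 : rMatrix (conjMap A.val)
      = ((1 / 2 : ℂ) • pauliBasisᴴ) * (A.val ⊗ₖ A.val.map star) * pauliBasis := by
    rw [Matrix.mul_assoc, h3, ← Matrix.mul_assoc, h2, Matrix.one_mul]
  rw [h4, Matrix.det_conj_of_mul_eq_one h2 h1, Matrix.det_kronecker]
  have h5 : (A.val.map star).det = star A.val.det := by
    rw [← Matrix.det_conjTranspose, ← Matrix.det_transpose A.valᴴ]
    rfl
  rw [h5, A.2]
  simp

theorem lorentzOf_zero_zero_pos (A : Matrix.SpecialLinearGroup (Fin 2) ℂ) :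
    0 < lorentzOf A 0 0 := by
  have hd := A.2
  rw [Matrix.det_fin_two] at hd
  have h : lorentzOf A 0 0 = 1 / 2 * (Complex.normSq (A.val 0 0) + Complex.normSq (A.val 0 1)
      + Complex.normSq (A.val 1 0) + Complex.normSq (A.val 1 1)) := by
    simp [lorentzOf, pauli, Matrix.trace, Matrix.mul_apply, Fin.sum_univ_two, Complex.normSq_apply]
    ring
  rw [h]
  have h0 := Complex.normSq_nonneg (A.val 0 0)
  have h1 := Complex.normSq_nonneg (A.val 0 1)
  have h2 := Complex.normSq_nonneg (A.val 1 0)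
  have h3 := Complex.normSq_nonneg (A.val 1 1)
  rcases eq_or_ne (A.val 0 0) 0 with h4 | h4
  · have h5 : A.val 0 1 ≠ 0 := by
      intro h5
      rw [h4, h5] at hd
      simp at hd
    have := Complex.normSq_pos.2 h5
    positivity
  · have := Complex.normSq_pos.2 h4
    positivity

theorem isLorentz_lorentzOf (A : Matrix.SpecialLinearGroup (Fin 2) ℂ) : IsLorentz (lorentzOf A) :=
  ⟨lorentzOf_minkowski A, lorentzOf_det A, lorentzOf_zero_zero_pos A⟩

/-- The Hermitian matrix `∑ i, v i σ i` with Pauli coordinates `v`. -/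
def hermOf (v : Fin 4 → ℝ) : QubitOp := ∑ i, (v i : ℂ) • pauli i

theorem hermOf_eq (v : Fin 4 → ℝ) :
    hermOf v = !![(v 0 : ℂ) + v 3, v 1 - Complex.I * v 2; v 1 + Complex.I * v 2, v 0 - v 3] := by
  ext a b
  fin_cases a <;> fin_cases b <;> simp [hermOf, Fin.sum_univ_four, pauli] <;> ring

theorem hermOf_injective : Function.Injective hermOf := by
  intro v w h
  rw [hermOf_eq, hermOf_eq] at h
  have h00 := congrFun (congrFun h 0) 0
  have h11 := congrFun (congrFun h 1) 1
  have h10 := congrFun (congrFun h 1) 0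
  simp only [Matrix.of_apply, Matrix.cons_val', Matrix.cons_val_zero, Matrix.cons_val_one,
    Matrix.cons_val_fin_one] at h00 h11 h10
  have e0 := congrArg Complex.re h00
  have e3 := congrArg Complex.re h11
  have e1 := congrArg Complex.re h10
  have e2 := congrArg Complex.im h10
  simp at e0 e1 e2 e3
  ext i
  fin_cases i <;> simp <;> linarith

theorem conjMap_hermOf (A : Matrix.SpecialLinearGroup (Fin 2) ℂ) (v : Fin 4 → ℝ) :
    conjMap A.val (hermOf v) = hermOf (lorentzOf A *ᵥ v) := by
  rw [hermOf, map_sum]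
  simp only [map_smul, map_pauli, ← lorentzOf_map, hermOf, Matrix.map_apply, Matrix.mulVec,
    dotProduct, Complex.ofReal_sum, Complex.ofReal_mul, Finset.sum_smul, Finset.smul_sum, smul_smul]
  rw [Finset.sum_comm]
  refine Finset.sum_congr rfl fun k _ => Finset.sum_congr rfl fun l _ => ?_
  rw [mul_comm]

/-- A future-directed lightlike vector is the vector of a spinor. -/
theorem exists_spinor (v : Fin 4 → ℝ) (h0 : 0 < v 0)
    (hq : v 0 ^ 2 = v 1 ^ 2 + v 2 ^ 2 + v 3 ^ 2) :
    ∃ f : Fin 2 → ℂ, hermOf v = Matrix.vecMulVec f (star f) := by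
  rcases eq_or_ne (v 0 + v 3) 0 with h | h
  · have h1 : v 1 = 0 := by nlinarith [sq_nonneg (v 1), sq_nonneg (v 2)]
    have h2 : v 2 = 0 := by nlinarith [sq_nonneg (v 1), sq_nonneg (v 2)]
    have h3 : v 3 = -v 0 := by linarith
    refine ⟨![0, (√(2 * v 0) : ℝ)], ?_⟩
    rw [hermOf_eq]
    have e : ((√(2 * v 0) : ℝ) : ℂ) * ((√(2 * v 0) : ℝ) : ℂ) = 2 * v 0 := by
      rw [← Complex.ofReal_mul, Real.mul_self_sqrt (by linarith)]
      push_cast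
      ring
    ext a b
    fin_cases a <;> fin_cases b <;> simp [Matrix.vecMulVec, h1, h2, h3, -Nat.ofNat_nonneg,
      -Real.sqrt_mul]
    rw [e]
    ring
  · have hp : 0 < v 0 + v 3 := by
      refine lt_of_le_of_ne ?_ (Ne.symm h)
      nlinarith [sq_nonneg (v 1), sq_nonneg (v 2)]
    set s := √(v 0 + v 3) with hs
    have hs0 : 0 < s := Real.sqrt_pos.2 hp
    have hss : (s : ℂ) * s = v 0 + v 3 := by
      rw [← Complex.ofReal_mul, Real.mul_self_sqrt hp.le]
      push_cast
      ring
    have hsc : (s : ℂ) ≠ 0 := by exact_mod_cast hs0.ne'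
    have hqc : (v 0 : ℂ) ^ 2 = v 1 ^ 2 + v 2 ^ 2 + v 3 ^ 2 := by exact_mod_cast hq
    refine ⟨![(s : ℂ), (v 1 + Complex.I * v 2) / s], ?_⟩
    rw [hermOf_eq]
    ext a b
    fin_cases a <;> fin_cases b <;> simp [Matrix.vecMulVec, hss]
    · field_simp
      ring
    · field_simp
    · rw [div_mul_div_comm, hss]
      have hne : (v 0 : ℂ) + v 3 ≠ 0 := by rw [← hss]; exact mul_ne_zero hsc hsc
      field_simp
      linear_combination hqc + (v 2 : ℂ) ^ 2 * Complex.I_sq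

/-- A Lorentz matrix fixing the time and the third space axis is a rotation about that axis. -/
theorem exists_lorentzOf_of_fix {M : Matrix (Fin 4) (Fin 4) ℝ}
    (hM : Mᵀ * minkowski * M = minkowski) (hd : M.det = 1)
    (h0 : ∀ i, M i 0 = if i = 0 then 1 else 0) (h3 : ∀ i, M i 3 = if i = 3 then 1 else 0) :
    ∃ A : Matrix.SpecialLinearGroup (Fin 2) ℂ, lorentzOf A = M := by
  have hM' : ∀ i j, (Mᵀ * minkowski * M) i j = minkowski i j := fun i j => by rw [hM]
  have a00 := h0 0
  have a10 := h0 1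
  have a20 := h0 2
  have a30 := h0 3
  have a03 := h3 0
  have a13 := h3 1
  have a23 := h3 2
  have a33 := h3 3
  simp at a00 a10 a20 a30 a03 a13 a23 a33
  have b01 := hM' 0 1
  have b02 := hM' 0 2
  have b31 := hM' 3 1
  have b32 := hM' 3 2
  have b11 := hM' 1 1
  have b12 := hM' 1 2
  have b22 := hM' 2 2
  simp [minkowski, Matrix.mul_apply, Fin.sum_univ_four, a00, a10, a20, a30,
    a03, a13, a23, a33] at b01 b02 b31 b32
  simp [minkowski, Matrix.mul_apply, Fin.sum_univ_four, b01, b02,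
    b31, b32] at b11 b12 b22
  have hd' : M 1 1 * M 2 2 - M 1 2 * M 2 1 = 1 := by
    rw [← hd, Matrix.det_succ_column_zero]
    simp [Fin.sum_univ_succ, Matrix.det_fin_three, a00, Fin.succAbove,
      a03, a13, a23, a33, b01, b02, b31, b32]
  have c22 : M 2 2 = M 1 1 := by
    linear_combination M 1 1 * hd' + M 2 1 * (-b12) - M 2 2 * (-b11)
  have c12 : M 1 2 = -M 2 1 := by
    linear_combination -M 2 1 * hd' - M 1 1 * b12 - M 1 2 * (-b11)
  obtain ⟨w, hw⟩ := IsAlgClosed.exists_pow_nat_eq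
    ((M 1 1 : ℂ) - Complex.I * M 2 1) (n := 2) (by norm_num)
  have hn : Complex.normSq w = 1 := by
    have h := congrArg Complex.normSq hw
    rw [map_pow, Complex.normSq_apply (_ - _)] at h
    simp at h
    have h1 : Complex.normSq w ^ 2 = 1 := by linear_combination h - b11
    exact (pow_eq_one_iff_of_nonneg (Complex.normSq_nonneg w) two_ne_zero).1 h1
  -- `diag(w, w̄)` multiplies the coordinate `v₁ - i v₂` by `w²`
  have hwr := congrArg Complex.re hw
  have hwi := congrArg Complex.im hw
  rw [sq] at hwr hwi
  simp at hwr hwi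
  rw [Complex.normSq_apply] at hn
  refine ⟨⟨!![w, 0; 0, star w], ?_⟩, ?_⟩
  · rw [Matrix.det_fin_two_of]
    simp [Complex.mul_conj, Complex.normSq_apply, hn]
  · have hT : (!![w, 0; 0, starRingEnd ℂ w] : QubitOp)ᴴ = !![starRingEnd ℂ w, 0; 0, w] := by
      ext a b
      fin_cases a <;> fin_cases b <;> simp
    ext i j
    fin_cases i <;> fin_cases j <;>
      simp [lorentzOf, pauli, hT, Matrix.trace_fin_two_of, a00, a10, a20, a30,
        a03, a13, a23, a33, b01, b02, b31, b32, c22, c12] <;>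
      linarith

/-- The spinor map is onto the proper orthochronous Lorentz group. The lightlike vectors
`L (e₀ ± e₃)` come from two spinors; the matrix with these spinors as columns realizes `L` up to
a rotation about the third axis. -/
theorem exists_lorentzOf_eq {L : Matrix (Fin 4) (Fin 4) ℝ} (hL : IsLorentz L) :
    ∃ A : Matrix.SpecialLinearGroup (Fin 2) ℂ, lorentzOf A = L := by
  obtain ⟨hm, hd, h0⟩ := hL
  have hM' : ∀ i j, (Lᵀ * minkowski * L) i j = minkowski i j := fun i j => by rw [hm]
  have hr : (L * minkowski * Lᵀ) 0 0 = minkowski 0 0 := by rw [mul_minkowski_mul_transpose hm]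
  have q00 := hM' 0 0
  have q03 := hM' 0 3
  have q33 := hM' 3 3
  simp [minkowski, Matrix.mul_apply, Fin.sum_univ_four] at q00 q03 q33 hr
  -- the lightlike vectors `L (e₀ ± e₃)` are future-directed
  have hlt : |L 0 3| < L 0 0 := by
    apply abs_lt_of_sq_lt_sq _ h0.le
    nlinarith [sq_nonneg (L 0 1), sq_nonneg (L 0 2)]
  obtain ⟨hlt1, hlt2⟩ := abs_lt.1 hlt
  obtain ⟨f, hf⟩ := exists_spinor (L *ᵥ ![1 / 2, 0, 0, 1 / 2])
    (by simp [Matrix.mulVec, dotProduct, Fin.sum_univ_four]; linarith)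
    (by simp [Matrix.mulVec, dotProduct, Fin.sum_univ_four]
        linear_combination (1 / 4) * q00 + (1 / 2) * q03 + (1 / 4) * q33)
  obtain ⟨g, hg⟩ := exists_spinor (L *ᵥ ![1 / 2, 0, 0, -(1 / 2)])
    (by simp [Matrix.mulVec, dotProduct, Fin.sum_univ_four]; linarith)
    (by simp [Matrix.mulVec, dotProduct, Fin.sum_univ_four]
        linear_combination (1 / 4) * q00 - (1 / 2) * q03 + (1 / 4) * q33)
  -- `|d|²` is the determinant of `L e₀`, so `d` is a phase, which is absorbed into `g`
  set d : ℂ := f 0 * g 1 - g 0 * f 1 with hdd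
  have hdn : d * star d = 1 := by
    have hsum : Matrix.vecMulVec f (star f) + Matrix.vecMulVec g (star g)
        = hermOf (L *ᵥ ![1, 0, 0, 0]) := by
      rw [← hf, ← hg, hermOf, hermOf, ← Finset.sum_add_distrib, hermOf]
      refine Finset.sum_congr rfl fun i _ => ?_
      rw [← add_smul, ← Complex.ofReal_add]
      congr 2
      simp [Matrix.mulVec, dotProduct, Fin.sum_univ_four]
      ring
    have := congrArg Matrix.det hsum
    rw [hermOf_eq, Matrix.det_fin_two, Matrix.det_fin_two_of] at this
    simp [Matrix.mulVec, dotProduct, Fin.sum_univ_four, Matrix.vecMulVec] at this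
    have q00c : ((L 0 0 * L 0 0 - L 1 0 * L 1 0 - L 2 0 * L 2 0 - L 3 0 * L 3 0 : ℝ) : ℂ) = 1 := by
      rw [← Complex.ofReal_one]
      congr 1
    push_cast at q00c
    simp [hdd]
    linear_combination this + q00c + (L 2 0 : ℂ) ^ 2 * Complex.I_sq
  let S : Matrix.SpecialLinearGroup (Fin 2) ℂ :=
    ⟨!![f 0, star d * g 0; f 1, star d * g 1], by
      rw [Matrix.det_fin_two_of]
      linear_combination hdn⟩
  have hSp : lorentzOf S *ᵥ ![1 / 2, 0, 0, 1 / 2] = L *ᵥ ![1 / 2, 0, 0, 1 / 2] := by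
    apply hermOf_injective
    have e : hermOf ![1 / 2, 0, 0, 1 / 2] = !![1, 0; 0, 0] := by
      rw [hermOf_eq]
      ext a b
      fin_cases a <;> fin_cases b <;> simp <;> norm_num
    rw [← conjMap_hermOf, hf, e]
    ext a b
    fin_cases a <;> fin_cases b <;>
      simp [S, Matrix.mul_apply, Fin.sum_univ_two, Matrix.vecMulVec]
  have hSm : lorentzOf S *ᵥ ![1 / 2, 0, 0, -(1 / 2)] = L *ᵥ ![1 / 2, 0, 0, -(1 / 2)] := by
    apply hermOf_injective
    have e : hermOf ![1 / 2, 0, 0, -(1 / 2)] = !![0, 0; 0, 1] := by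
      rw [hermOf_eq]
      ext a b
      fin_cases a <;> fin_cases b <;> simp <;> norm_num
    rw [← conjMap_hermOf, hg, e]
    simp only [RCLike.star_def] at hdn
    ext a b
    fin_cases a <;> fin_cases b <;>
      simp [S, Matrix.mul_apply, Fin.sum_univ_two, Matrix.vecMulVec]
    · linear_combination (g 0 * starRingEnd ℂ (g 0)) * hdn
    · linear_combination (g 0 * starRingEnd ℂ (g 1)) * hdn
    · linear_combination (g 1 * starRingEnd ℂ (g 0)) * hdn
    · linear_combination (g 1 * starRingEnd ℂ (g 1)) * hdn
  have hcol : ∀ i, (lorentzOf S⁻¹ * L) i 0 = (if i = 0 then 1 else 0) ∧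
      (lorentzOf S⁻¹ * L) i 3 = if i = 3 then 1 else 0 := by
    have e1 : (lorentzOf S⁻¹ * L) *ᵥ ![1 / 2, 0, 0, 1 / 2] = ![1 / 2, 0, 0, 1 / 2] := by
      rw [← Matrix.mulVec_mulVec, ← hSp, Matrix.mulVec_mulVec, lorentzOf_inv_mul, Matrix.one_mulVec]
    have e2 : (lorentzOf S⁻¹ * L) *ᵥ ![1 / 2, 0, 0, -(1 / 2)] = ![1 / 2, 0, 0, -(1 / 2)] := by
      rw [← Matrix.mulVec_mulVec, ← hSm, Matrix.mulVec_mulVec, lorentzOf_inv_mul, Matrix.one_mulVec]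
    intro i
    have f1 := congrFun e1 i
    have f2 := congrFun e2 i
    generalize lorentzOf S⁻¹ * L = M at f1 f2 ⊢
    fin_cases i <;> simp [Matrix.mulVec, dotProduct, Fin.sum_univ_four] at f1 f2 ⊢ <;>
      constructor <;> linarith
  obtain ⟨D, hD⟩ := exists_lorentzOf_of_fix (M := lorentzOf S⁻¹ * L)
    (minkowski_preserved_mul (lorentzOf_minkowski _) hm)
    (by rw [Matrix.det_mul, lorentzOf_det, hd, one_mul])
    (fun i => (hcol i).1) (fun i => (hcol i).2)
  exact ⟨S * D, by rw [lorentzOf_mul, hD, ← Matrix.mul_assoc, lorentzOf_mul_inv, Matrix.one_mul]⟩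

/-! ### Kraus operators of the normal forms -/

/-- Kraus operators of a normal form yield Kraus operators of every map with that normal form. -/
theorem HasNormalFormVia.isKrausFamily {ι : Type*} [Fintype ι] {Φ : QubitMap}
    {N : Matrix (Fin 4) (Fin 4) ℝ} {c : ℝ} {A B : Matrix.SpecialLinearGroup (Fin 2) ℂ}
    (h : HasNormalFormVia Φ N c A B) (hc : 0 ≤ c) {K : ι → QubitOp}
    (hK : IsKrausFamily K (mapOfRMatrix (N.map Complex.ofReal))) :
    IsKrausFamily (fun i => (((√c : ℝ) : ℂ) • B.val) * K i * A.val) Φ := by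
  obtain ⟨Ω, hΩ, hf⟩ := h
  have e : Ω = (c : ℂ) • mapOfRMatrix (N.map Complex.ofReal) := by
    apply rMatrix_injective
    rw [hΩ, rMatrix_smul, rMatrix_mapOfRMatrix, map_ofReal_smul]
  intro X
  rw [hf X, e, LinearMap.smul_apply, hK, Finset.smul_sum, Matrix.mul_sum, Matrix.sum_mul]
  refine Finset.sum_congr rfl fun i _ => ?_
  have hs : (c : ℂ) = ((√c : ℝ) : ℂ) * ((√c : ℝ) : ℂ) := by
    rw [← Complex.ofReal_mul, Real.mul_self_sqrt hc]
  simp only [Matrix.conjTranspose_mul, Matrix.conjTranspose_smul, Matrix.smul_mul, Matrix.mul_smul,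
    smul_smul, Matrix.mul_assoc, RCLike.star_def, Complex.conj_ofReal]
  rw [hs]

theorem isKrausFamily_diagForm {s₁ s₂ s₃ : ℝ} {p : Fin 4 → ℝ} (hp : IsBellCoeff p s₁ s₂ s₃) :
    IsKrausFamily (fun i => (p i : ℂ) • pauli i)
      (mapOfRMatrix ((diagForm s₁ s₂ s₃).map Complex.ofReal)) := by
  have hc : ∀ i, (p i : ℂ) ^ 2 = (bellEigenvalue s₁ s₂ s₃ i : ℂ) := fun i => by
    exact_mod_cast (hp i).2
  have h0 := hc 0
  have h1 := hc 1
  have h2 := hc 2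
  have h3 := hc 3
  simp [bellEigenvalue] at h0 h1 h2 h3
  intro X
  rw [mapOfRMatrix_apply]
  ext a b
  fin_cases a <;> fin_cases b <;>
    simp [Fin.sum_univ_four, pauli, diagForm, Matrix.trace, Matrix.mul_apply, Matrix.vecMul,
      Fin.sum_univ_two, Matrix.vecHead, Matrix.vecTail]
  · linear_combination -X 0 0 * h0 - X 1 1 * h1 - X 1 1 * h2 - X 0 0 * h3
      + (p 2 : ℂ) ^ 2 * X 1 1 * Complex.I_sq
  · linear_combination -X 0 1 * h0 - X 1 0 * h1 + X 1 0 * h2 + X 0 1 * h3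
      - ((p 2 : ℂ) ^ 2 * X 1 0 + s₂ * (X 0 1 - X 1 0) / 2) * Complex.I_sq
  · linear_combination -X 1 0 * h0 - X 0 1 * h1 + X 0 1 * h2 + X 1 0 * h3
      - ((p 2 : ℂ) ^ 2 * X 0 1 + s₂ * (X 1 0 - X 0 1) / 2) * Complex.I_sq
  · linear_combination -X 1 1 * h0 - X 0 0 * h1 - X 0 0 * h2 - X 1 1 * h3
      + (p 2 : ℂ) ^ 2 * X 0 0 * Complex.I_sq

theorem isKrausFamily_nonDiagForm {x : ℝ} (h0 : 0 ≤ x) (h1 : x ≤ 1) :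
    IsKrausFamily ![((√((1 + x) / 2) : ℝ) : ℂ) • (!![1, 0; 0, ((1 / √3 : ℝ) : ℂ)] : QubitOp),
      ((√((1 - x) / 2) : ℝ) : ℂ) • !![1, 0; 0, -((1 / √3 : ℝ) : ℂ)],
      ((√(2 / 3) : ℝ) : ℂ) • !![0, 1; 0, 0]]
      (mapOfRMatrix ((nonDiagForm x).map Complex.ofReal)) := by
  have e1 : √((1 + x) / 2) ^ 2 = (1 + x) / 2 := Real.sq_sqrt (by linarith)
  have e2 : √((1 - x) / 2) ^ 2 = (1 - x) / 2 := Real.sq_sqrt (by linarith)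
  have e3 : √(2 / 3) ^ 2 = 2 / 3 := Real.sq_sqrt (by norm_num)
  have e4 : (1 / √3) ^ 2 = 1 / 3 := by
    rw [div_pow, Real.sq_sqrt (by norm_num), one_pow]
  have e5 : x / √3 = x * (1 / √3) := by ring
  intro X
  rw [mapOfRMatrix_apply, Fin.sum_univ_three]
  simp only [nonDiagForm, e5]
  generalize √((1 + x) / 2) = u at *
  generalize √((1 - x) / 2) = v at *
  generalize √(2 / 3) = w at *
  generalize 1 / √3 = r at *
  have f1 : (u : ℂ) ^ 2 = (1 + x) / 2 := by exact_mod_cast e1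
  have f2 : (v : ℂ) ^ 2 = (1 - x) / 2 := by exact_mod_cast e2
  have f3 : (w : ℂ) ^ 2 = 2 / 3 := by rw [← Complex.ofReal_pow, e3]; norm_num
  have f4 : (r : ℂ) ^ 2 = 1 / 3 := by rw [← Complex.ofReal_pow, e4]; norm_num
  ext a b
  fin_cases a <;> fin_cases b <;>
    simp [Fin.sum_univ_four, pauli, Matrix.trace, Matrix.mul_apply, Matrix.vecMul,
      Fin.sum_univ_two, Matrix.vecHead, Matrix.vecTail]
  · linear_combination -X 0 0 * f1 - X 0 0 * f2 - X 1 1 * f3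
  · linear_combination -X 0 1 * r * f1 + X 0 1 * r * f2
      - x * r * (X 0 1 - X 1 0) / 2 * Complex.I_sq
  · linear_combination -X 1 0 * r * f1 + X 1 0 * r * f2
      - x * r * (X 1 0 - X 0 1) / 2 * Complex.I_sq
  · linear_combination -X 1 1 * r ^ 2 * f1 - X 1 1 * r ^ 2 * f2 - X 1 1 * f4

theorem HasNormalFormVia.isKrausFamily_diag {Φ : QubitMap} {s₁ s₂ s₃ c : ℝ}
    {A B : Matrix.SpecialLinearGroup (Fin 2) ℂ}
    (h : HasNormalFormVia Φ (diagForm s₁ s₂ s₃) c A B) (hc : 0 ≤ c) {p : Fin 4 → ℝ}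
    (hp : IsBellCoeff p s₁ s₂ s₃) :
    IsKrausFamily (diagKraus p (((√c : ℝ) : ℂ) • B.val) A.val) Φ := by
  convert h.isKrausFamily hc (isKrausFamily_diagForm hp) using 1
  ext1 i
  simp [diagKraus]

theorem HasNormalFormVia.isKrausFamily_nonDiag {Φ : QubitMap} {x c : ℝ}
    {A B : Matrix.SpecialLinearGroup (Fin 2) ℂ}
    (h : HasNormalFormVia Φ (nonDiagForm x) c A B) (hc : 0 ≤ c) (h0 : 0 ≤ x) (h1 : x ≤ 1) :
    IsKrausFamily (nonDiagKraus x (((√c : ℝ) : ℂ) • B.val) A.val) Φ := by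
  convert h.isKrausFamily hc (isKrausFamily_nonDiagForm h0 h1) using 1
  have key : ∀ (z : ℂ) (S K T : QubitOp), z • (S * K * T) = S * (z • K) * T := fun z S K T => by
    rw [Matrix.mul_smul, Matrix.smul_mul]
  ext1 i
  fin_cases i
  · exact key _ _ _ _
  · exact key _ _ _ _
  · exact key _ _ _ _

theorem DiagParams.exists_isBellCoeff {s₁ s₂ s₃ : ℝ} (h : DiagParams s₁ s₂ s₃) :
    ∃ p, IsBellCoeff p s₁ s₂ s₃ := by
  obtain ⟨h1, h2, h3, h4⟩ := h
  obtain ⟨h5, h6⟩ := abs_le.1 h3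
  refine ⟨fun i => √(bellEigenvalue s₁ s₂ s₃ i), fun i => ⟨Real.sqrt_nonneg _, Real.sq_sqrt ?_⟩⟩
  fin_cases i <;> simp [bellEigenvalue] <;> linarith

theorem det_smul_specialLinear_ne_zero {c : ℝ} (hc : 0 < c)
    (B : Matrix.SpecialLinearGroup (Fin 2) ℂ) : ((((√c : ℝ) : ℂ) • B.val).det) ≠ 0 := by
  rw [Matrix.det_smul, B.2, mul_one]
  exact pow_ne_zero _ (by exact_mod_cast (Real.sqrt_pos.2 hc).ne')

/-! ### The trivial maps -/

theorem posSemidef_single (i : Fin 2) : (Matrix.single i i (1 : ℂ) : QubitOp).PosSemidef := by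
  have h := Matrix.posSemidef_vecMulVec_self_star (Pi.single i (1 : ℂ))
  convert h using 1
  ext a b
  fin_cases i <;> fin_cases a <;> fin_cases b <;> simp [Matrix.vecMulVec]

theorem mapOfRMatrix_constForm (X : QubitOp) :
    mapOfRMatrix (constForm.map Complex.ofReal) X = X.trace • Matrix.single 0 0 (1 : ℂ) := by
  rw [mapOfRMatrix_apply]
  ext a b
  fin_cases a <;> fin_cases b <;>
    simp [Fin.sum_univ_four, pauli, constForm, Matrix.trace, Matrix.mul_apply, Fin.sum_univ_two]
  ring

/-- A trace-preserving map whose normal form is the third one sends all states to one state: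
its values are multiples of one positive matrix, and the trace fixes the multiple. -/
theorem HasNormalForm.eq_trace_smul {Φ : QubitMap} (hΦ : IsTracePreserving Φ)
    (h : HasNormalForm Φ constForm) :
    ∃ τ : QubitOp, τ.PosSemidef ∧ τ.trace = 1 ∧ ∀ X : QubitOp, Φ X = X.trace • τ := by
  obtain ⟨c, hc, A, B, Ω, hΩ, hf⟩ := h
  set P : QubitOp := (c : ℂ) • (B.val * Matrix.single 0 0 (1 : ℂ) * B.valᴴ) with hP
  have e : ∀ X, Φ X = (A.val * X * A.valᴴ).trace • P := by
    intro X
    have hΩ' : Ω = (c : ℂ) • mapOfRMatrix (constForm.map Complex.ofReal) := by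
      apply rMatrix_injective
      rw [hΩ, rMatrix_smul, rMatrix_mapOfRMatrix, map_ofReal_smul]
    rw [hf X, hΩ', LinearMap.smul_apply, mapOfRMatrix_constForm, hP]
    simp only [Matrix.mul_smul, Matrix.smul_mul, smul_smul]
    rw [mul_comm]
  have ht : ∀ X : QubitOp, X.trace = (A.val * X * A.valᴴ).trace * P.trace := by
    intro X
    rw [← hΦ X, e X, Matrix.trace_smul, smul_eq_mul]
  have hP0 : P.trace ≠ 0 := by
    intro h0
    have := ht 1
    rw [h0, mul_zero] at this
    simp at this
  have hPpos : P.PosSemidef := by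
    exact ((posSemidef_single 0).mul_mul_conjTranspose_same _).smul (by exact_mod_cast hc.le)
  clear_value P
  refine ⟨P.trace⁻¹ • P, hPpos.smul (inv_nonneg_of_nonneg hPpos.trace_nonneg), ?_, fun X => ?_⟩
  · rw [Matrix.trace_smul, smul_eq_mul, inv_mul_cancel₀ hP0]
  · rw [e X, smul_smul, ht X, mul_inv_cancel_right₀ hP0]

/-! ### Uniqueness of the normal form -/

/-- The matrix `η Nᵀ η N`. It changes by a similarity when `N` is multiplied by Lorentz
transformations from both sides, so that its spectrum and Jordan structure are invariants. -/
def lorentzGram (N : Matrix (Fin 4) (Fin 4) ℝ) : Matrix (Fin 4) (Fin 4) ℝ :=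
  minkowski * Nᵀ * minkowski * N

theorem lorentzGram_mul {k : ℝ} {M₁ N M₂ : Matrix (Fin 4) (Fin 4) ℝ}
    (h1 : M₁ᵀ * minkowski * M₁ = minkowski) (h2 : M₂ᵀ * minkowski * M₂ = minkowski) :
    M₂ * lorentzGram (k • (M₁ * N * M₂)) = (k ^ 2 • lorentzGram N) * M₂ := by
  have h3 := mul_minkowski_mul_transpose h2
  simp only [lorentzGram, Matrix.transpose_smul, Matrix.transpose_mul, Matrix.mul_smul,
    Matrix.smul_mul, smul_smul, ← sq]
  congr 1
  calc M₂ * (minkowski * (M₂ᵀ * (Nᵀ * M₁ᵀ)) * minkowski * (M₁ * N * M₂))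
      = (M₂ * minkowski * M₂ᵀ) * Nᵀ * (M₁ᵀ * minkowski * M₁) * N * M₂ := by
        simp only [Matrix.mul_assoc]
    _ = minkowski * Nᵀ * minkowski * N * M₂ := by rw [h1, h3]

theorem lorentzGram_diagForm (s₁ s₂ s₃ : ℝ) :
    lorentzGram (diagForm s₁ s₂ s₃) = Matrix.diagonal ![1, s₁ ^ 2, s₂ ^ 2, s₃ ^ 2] := by
  ext i j
  fin_cases i <;> fin_cases j <;>
    simp [lorentzGram, minkowski, diagForm, Matrix.mul_apply, Fin.sum_univ_four,
      Matrix.diagonal_apply, sq]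

theorem lorentzGram_nonDiagForm (x : ℝ) :
    lorentzGram (nonDiagForm x)
      = !![5 / 9, 0, 0, -2 / 9; 0, x ^ 2 / 3, 0, 0; 0, 0, x ^ 2 / 3, 0; 2 / 9, 0, 0, 1 / 9] := by
  have e : x / √3 * (x / √3) = x ^ 2 / 3 := by
    rw [div_mul_div_comm, Real.mul_self_sqrt (by norm_num), sq]
  ext i j
  fin_cases i <;> fin_cases j <;>
    simp [lorentzGram, minkowski, nonDiagForm, Matrix.mul_apply, Fin.sum_univ_four,
      Matrix.diagonal_apply, e] <;> norm_num

theorem lorentzGram_constForm : lorentzGram constForm = 0 := by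
  ext i j
  fin_cases i <;> fin_cases j <;>
    simp [lorentzGram, minkowski, constForm, Matrix.mul_apply, Fin.sum_univ_four,
      Matrix.diagonal_apply]

/-- Equality up to a positive factor and multiplication by Lorentz matrices of determinant one from
both sides: the relation between two normal forms of one map. -/
def LorentzRelated (N N' : Matrix (Fin 4) (Fin 4) ℝ) : Prop :=
  ∃ (k : ℝ) (M₁ M₂ : Matrix (Fin 4) (Fin 4) ℝ), 0 < k ∧ M₁ᵀ * minkowski * M₁ = minkowski ∧
    M₂ᵀ * minkowski * M₂ = minkowski ∧ M₁.det = 1 ∧ M₂.det = 1 ∧ N' = k • (M₁ * N * M₂)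

theorem HasNormalForm.related {Φ : QubitMap} {N N' : Matrix (Fin 4) (Fin 4) ℝ}
    (h : HasNormalForm Φ N) (h' : HasNormalForm Φ N') : LorentzRelated N N' := by
  obtain ⟨c, hc, A, B, h⟩ := h
  obtain ⟨c', hc', A', B', h'⟩ := h'
  rw [hasNormalFormVia_iff] at h h'
  have e := ofReal_map_injective (h.symm.trans h')
  refine ⟨c'⁻¹ * c, lorentzOf (B'⁻¹ * B), lorentzOf (A * A'⁻¹), by positivity,
    lorentzOf_minkowski _, lorentzOf_minkowski _, lorentzOf_det _, lorentzOf_det _, ?_⟩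
  calc N' = c'⁻¹ •
        (lorentzOf B'⁻¹ * (c' • (lorentzOf B' * N' * lorentzOf A')) * lorentzOf A'⁻¹) := by
        rw [Matrix.mul_smul, Matrix.smul_mul, smul_smul, inv_mul_cancel₀ hc'.ne', one_smul,
          Matrix.mul_assoc, Matrix.mul_assoc, lorentzOf_mul_inv, Matrix.mul_one,
          ← Matrix.mul_assoc, lorentzOf_inv_mul, Matrix.one_mul]
    _ = _ := by
        rw [← e, Matrix.mul_smul, Matrix.smul_mul, smul_smul, lorentzOf_mul, lorentzOf_mul]
        simp only [Matrix.mul_assoc]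

theorem LorentzRelated.gram {N N' : Matrix (Fin 4) (Fin 4) ℝ} (h : LorentzRelated N N') :
    ∃ (k : ℝ) (M : Matrix (Fin 4) (Fin 4) ℝ), 0 < k ∧ M.det = 1 ∧
      M * lorentzGram N' = (k ^ 2 • lorentzGram N) * M ∧ N'.det = k ^ 4 * N.det := by
  obtain ⟨k, M₁, M₂, hk, h1, h2, d1, d2, rfl⟩ := h
  refine ⟨k, M₂, hk, d2, lorentzGram_mul h1 h2, ?_⟩
  rw [Matrix.det_smul, Matrix.det_mul, Matrix.det_mul, d1, d2, Fintype.card_fin, one_mul, mul_one]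

theorem det_sub_eq_of_similar {M C D : Matrix (Fin 4) (Fin 4) ℝ} (hM : M.det = 1)
    (h : M * C = D * M) (t : ℝ) :
    (t • (1 : Matrix (Fin 4) (Fin 4) ℝ) - C).det = (t • 1 - D).det := by
  have e : M * (t • 1 - C) = (t • 1 - D) * M := by
    rw [Matrix.mul_sub, Matrix.sub_mul, h]
    simp
  have := congrArg Matrix.det e
  rwa [Matrix.det_mul, Matrix.det_mul, hM, one_mul, mul_one] at this

/-- Two ordered quadruples of reals that are the roots of the same monic quartic agree. -/
theorem eq_of_prod_sub_eq {a b c d a' b' c' d' : ℝ} (h1 : b ≤ a) (h2 : c ≤ b) (h3 : d ≤ c)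
    (h1' : b' ≤ a') (h2' : c' ≤ b') (h3' : d' ≤ c')
    (h : ∀ t : ℝ, (t - a) * (t - b) * (t - c) * (t - d)
      = (t - a') * (t - b') * (t - c') * (t - d')) :
    a = a' ∧ b = b' ∧ c = c' ∧ d = d' := by
  open Polynomial in
  have hp : ((([a, b, c, d] : List ℝ) : Multiset ℝ).map fun r => X - C r).prod
      = ((([a', b', c', d'] : List ℝ) : Multiset ℝ).map fun r => X - C r).prod := by
    apply Polynomial.funext
    intro t
    simpa [mul_assoc] using h t
  have hr := congrArg Polynomial.roots hp
  rw [Polynomial.roots_multiset_prod_X_sub_C, Polynomial.roots_multiset_prod_X_sub_C,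
    Multiset.coe_eq_coe] at hr
  have := hr.eq_of_pairwise' (r := (· ≥ ·)) (by simp; grind) (by simp; grind)
  simpa using this

theorem det_sub_diagonal (t k a b c d : ℝ) :
    (t • 1 - k • Matrix.diagonal ![a, b, c, d]).det
      = (t - k * a) * (t - k * b) * (t - k * c) * (t - k * d) := by
  have e : t • 1 - k • Matrix.diagonal ![a, b, c, d]
      = Matrix.diagonal ![t - k * a, t - k * b, t - k * c, t - k * d] := by
    ext i j
    fin_cases i <;> fin_cases j <;> simp
  rw [e, Matrix.det_diagonal, Fin.prod_univ_four]
  simp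

theorem det_sub_nonDiag (t k y : ℝ) :
    (t • 1 - k • (!![5 / 9, 0, 0, -2 / 9; 0, y, 0, 0; 0, 0, y, 0; 2 / 9, 0, 0, 1 / 9] :
        Matrix (Fin 4) (Fin 4) ℝ)).det
      = (t - k / 3) * (t - k / 3) * (t - k * y) * (t - k * y) := by
  have e : t • 1 - k • (!![5 / 9, 0, 0, -2 / 9; 0, y, 0, 0; 0, 0, y, 0; 2 / 9, 0, 0, 1 / 9] :
        Matrix (Fin 4) (Fin 4) ℝ)
      = !![t - k * (5 / 9), 0, 0, k * (2 / 9); 0, t - k * y, 0, 0; 0, 0, t - k * y, 0;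
        -k * (2 / 9), 0, 0, t - k * (1 / 9)] := by
    ext i j
    fin_cases i <;> fin_cases j <;> simp <;> ring
  rw [e]
  simp [Matrix.det_succ_row_zero, Fin.sum_univ_succ, Fin.succAbove]
  ring

theorem diagForm_unique {s₁ s₂ s₃ t₁ t₂ t₃ : ℝ} (hs : DiagParams s₁ s₂ s₃)
    (ht : DiagParams t₁ t₂ t₃) (h : LorentzRelated (diagForm s₁ s₂ s₃) (diagForm t₁ t₂ t₃)) :
    diagForm t₁ t₂ t₃ = diagForm s₁ s₂ s₃ := by
  obtain ⟨k, M, hk, hM, hg, hd⟩ := h.gram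
  obtain ⟨a1, a2, a3, -⟩ := hs
  obtain ⟨b1, b2, b3, -⟩ := ht
  have a0 : 0 ≤ s₂ := (abs_nonneg _).trans a3
  have b0 : 0 ≤ t₂ := (abs_nonneg _).trans b3
  have sq3 : s₃ ^ 2 ≤ s₂ ^ 2 := sq_le_sq.2 (by rwa [abs_of_nonneg a0])
  have tq3 : t₃ ^ 2 ≤ t₂ ^ 2 := sq_le_sq.2 (by rwa [abs_of_nonneg b0])
  have hk2 : 0 ≤ k ^ 2 := sq_nonneg k
  have hdet := det_sub_eq_of_similar hM hg
  simp only [lorentzGram_diagForm] at hdet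
  obtain ⟨e0, e1, e2, e3⟩ := eq_of_prod_sub_eq (a := 1) (b := t₁ ^ 2) (c := t₂ ^ 2) (d := t₃ ^ 2)
    (a' := k ^ 2 * 1) (b' := k ^ 2 * s₁ ^ 2) (c' := k ^ 2 * s₂ ^ 2) (d' := k ^ 2 * s₃ ^ 2)
    (by nlinarith) (by nlinarith) tq3
    (mul_le_mul_of_nonneg_left (by nlinarith) hk2) (mul_le_mul_of_nonneg_left (by nlinarith) hk2)
    (mul_le_mul_of_nonneg_left sq3 hk2) (fun t => by
      rw [← det_sub_diagonal, ← hdet t, ← one_smul ℝ (Matrix.diagonal _), det_sub_diagonal]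
      ring)
  have hk1 : k ^ 2 = 1 := by linarith
  rw [hk1, one_mul] at e1 e2 e3
  have f1 : t₁ = s₁ := (sq_eq_sq₀ (b0.trans b2) (a0.trans a2)).1 e1
  have f2 : t₂ = s₂ := (sq_eq_sq₀ b0 a0).1 e2
  have hdd : ∀ a b c : ℝ, (diagForm a b c).det = a * b * c := fun a b c => by
    simp [diagForm, Matrix.det_succ_row_zero, Fin.sum_univ_succ, Fin.succAbove]
    ring
  rw [hdd, hdd, show k ^ 4 = (k ^ 2) ^ 2 by ring, hk1, f1, f2] at hd
  have f3 : t₃ = s₃ := by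
    -- the determinant fixes the sign unless `s₃ = 0`
    rcases eq_or_ne s₂ 0 with h0 | h0
    · have : s₃ ^ 2 = 0 := by nlinarith [sq_nonneg s₃]
      rw [this] at e3
      rw [pow_eq_zero_iff two_ne_zero] at this e3
      rw [this, e3]
    · have h1 : s₁ ≠ 0 := by
        rintro rfl
        exact h0 (le_antisymm a2 a0)
      have h2 := mul_ne_zero h1 h0
      apply mul_left_cancel₀ h2
      linarith
  rw [f1, f2, f3]

theorem nonDiagForm_unique {x y : ℝ} (hx0 : 0 ≤ x) (hx1 : x ≤ 1) (hy0 : 0 ≤ y) (hy1 : y ≤ 1)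
    (h : LorentzRelated (nonDiagForm x) (nonDiagForm y)) : nonDiagForm y = nonDiagForm x := by
  obtain ⟨k, M, hk, hM, hg, -⟩ := h.gram
  have hdet := det_sub_eq_of_similar hM hg
  simp only [lorentzGram_nonDiagForm] at hdet
  have hk2 : 0 ≤ k ^ 2 := sq_nonneg k
  obtain ⟨e0, -, e2, -⟩ := eq_of_prod_sub_eq (a := 1 / 3) (b := 1 / 3) (c := y ^ 2 / 3)
    (d := y ^ 2 / 3) (a' := k ^ 2 / 3) (b' := k ^ 2 / 3) (c' := k ^ 2 * (x ^ 2 / 3))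
    (d' := k ^ 2 * (x ^ 2 / 3)) le_rfl (by nlinarith) le_rfl le_rfl
    (by nlinarith [mul_le_mul_of_nonneg_left (show x ^ 2 ≤ 1 by nlinarith) hk2]) le_rfl (fun t => by
      rw [← det_sub_nonDiag, ← hdet t]
      have := det_sub_nonDiag t 1 (y ^ 2 / 3)
      rw [one_smul] at this
      rw [this]
      ring)
  have hk1 : k ^ 2 = 1 := by linarith
  rw [hk1] at e2
  have : y = x := (sq_eq_sq₀ hy0 hx0).1 (by linarith)
  rw [this]

/-- A diagonal matrix is semisimple, whereas the Gram matrix of the second normal form has a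
Jordan block for the eigenvalue `1 / 3`. -/
theorem not_related_diag_nonDiag (s₁ s₂ s₃ x : ℝ) :
    ¬ LorentzRelated (diagForm s₁ s₂ s₃) (nonDiagForm x) := by
  intro h
  obtain ⟨k, M, hk, hM, hg, -⟩ := h.gram
  rw [lorentzGram_diagForm, lorentzGram_nonDiagForm] at hg
  set C : Matrix (Fin 4) (Fin 4) ℝ :=
    !![5 / 9, 0, 0, -2 / 9; 0, x ^ 2 / 3, 0, 0; 0, 0, x ^ 2 / 3, 0; 2 / 9, 0, 0, 1 / 9] with hC
  set d : Fin 4 → ℝ := ![1, s₁ ^ 2, s₂ ^ 2, s₃ ^ 2]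
  -- `C - 1/3` annihilates `e` only when applied twice
  set e : Fin 4 → ℝ := ![1, 0, 0, 0] with he
  have h1 : (C - (1 / 3 : ℝ) • 1) *ᵥ ((C - (1 / 3 : ℝ) • 1) *ᵥ e) = 0 := by
    ext i
    fin_cases i <;> simp [hC, he, Matrix.mulVec, dotProduct, Fin.sum_univ_four] <;> norm_num
  have h2 : (C - (1 / 3 : ℝ) • 1) *ᵥ e ≠ 0 := by
    intro h
    have := congrFun h 3
    simp [hC, he, Matrix.mulVec, dotProduct, Fin.sum_univ_four] at this
  have hD : M * (C - (1 / 3 : ℝ) • 1) = Matrix.diagonal (fun i => k ^ 2 * d i - 1 / 3) * M := by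
    have e1 : Matrix.diagonal (fun i => k ^ 2 * d i - 1 / 3)
        = k ^ 2 • Matrix.diagonal d - (1 / 3 : ℝ) • 1 := by
      rw [← Matrix.diagonal_one, ← Matrix.diagonal_smul, ← Matrix.diagonal_smul,
        Matrix.diagonal_sub]
      congr 1
      ext i
      simp
    rw [e1, Matrix.mul_sub, Matrix.sub_mul, hg]
    simp
  have hinj : ∀ v, M *ᵥ v = 0 → v = 0 := fun v hv =>
    Matrix.eq_zero_of_mulVec_eq_zero (by rw [hM]; exact one_ne_zero) hv
  apply h2
  apply hinj
  have h3 := congrArg (M *ᵥ ·) h1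
  simp only [Matrix.mulVec_mulVec, ← Matrix.mul_assoc, hD, Matrix.mulVec_zero] at h3
  rw [Matrix.mul_assoc, hD] at h3
  rw [Matrix.mulVec_mulVec, hD]
  ext i
  have h4 := congrFun h3 i
  rw [← Matrix.mulVec_mulVec, ← Matrix.mulVec_mulVec, Matrix.mulVec_diagonal,
    Matrix.mulVec_diagonal] at h4
  rw [← Matrix.mulVec_mulVec, Matrix.mulVec_diagonal]
  rw [Pi.zero_apply] at h4 ⊢
  rcases mul_eq_zero.1 h4 with h5 | h5
  · rw [h5, zero_mul]
  · exact h5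

theorem LorentzRelated.gram_eq_zero {N N' : Matrix (Fin 4) (Fin 4) ℝ} (h : LorentzRelated N N')
    (h0 : lorentzGram N = 0) : lorentzGram N' = 0 := by
  obtain ⟨k, M, -, hM, hg, -⟩ := h.gram
  rw [h0, smul_zero, Matrix.zero_mul] at hg
  have hu : IsUnit M.det := by rw [hM]; exact isUnit_one
  calc lorentzGram N' = M⁻¹ * (M * lorentzGram N') := by
        rw [← Matrix.mul_assoc, Matrix.nonsing_inv_mul _ hu, Matrix.one_mul]
    _ = 0 := by rw [hg, Matrix.mul_zero]

theorem lorentzGram_diagForm_ne_zero (s₁ s₂ s₃ : ℝ) : lorentzGram (diagForm s₁ s₂ s₃) ≠ 0 := by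
  intro h
  have := congrFun (congrFun h 0) 0
  simp [lorentzGram_diagForm] at this

theorem lorentzGram_nonDiagForm_ne_zero (x : ℝ) : lorentzGram (nonDiagForm x) ≠ 0 := by
  intro h
  have := congrFun (congrFun h 0) 0
  simp [lorentzGram_nonDiagForm] at this

theorem HasNormalForm.unique {Φ : QubitMap} {N N' : Matrix (Fin 4) (Fin 4) ℝ}
    (hN : IsNormalForm N) (hN' : IsNormalForm N') (h : HasNormalForm Φ N)
    (h' : HasNormalForm Φ N') : N' = N := by
  have r := h.related h'
  have r' := h'.related h
  rcases hN with ⟨s₁, s₂, s₃, hs, rfl⟩ | ⟨x, hx0, hx1, rfl⟩ | rfl <;>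
    rcases hN' with ⟨t₁, t₂, t₃, ht, rfl⟩ | ⟨y, hy0, hy1, rfl⟩ | rfl
  · exact diagForm_unique hs ht r
  · exact absurd r (not_related_diag_nonDiag _ _ _ _)
  · exact absurd (r'.gram_eq_zero lorentzGram_constForm) (lorentzGram_diagForm_ne_zero _ _ _)
  · exact absurd r' (not_related_diag_nonDiag _ _ _ _)
  · exact nonDiagForm_unique hx0 hx1 hy0 hy1 r
  · exact absurd (r'.gram_eq_zero lorentzGram_constForm) (lorentzGram_nonDiagForm_ne_zero _)
  · exact absurd (r.gram_eq_zero lorentzGram_constForm) (lorentzGram_diagForm_ne_zero _ _ _)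
  · exact absurd (r.gram_eq_zero lorentzGram_constForm) (lorentzGram_nonDiagForm_ne_zero _)
  · rfl

/-! ### Complete positivity -/

theorem Matrix.PosSemidef.re_diag_nonneg {n : Type*} {M : Matrix n n ℂ} (hM : M.PosSemidef)
    (i : n) : 0 ≤ (M i i).re := (Complex.nonneg_iff.1 hM.diag_nonneg).1

theorem Matrix.PosSemidef.im_diag {n : Type*} {M : Matrix n n ℂ} (hM : M.PosSemidef) (i : n) :
    (M i i).im = 0 := (Complex.nonneg_iff.1 hM.diag_nonneg).2.symm

/-- The principal minors of order two of a positive matrix are nonnegative. -/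
theorem Matrix.PosSemidef.normSq_le {n : Type*} {M : Matrix n n ℂ} (hM : M.PosSemidef) (i j : n) :
    Complex.normSq (M i j) ≤ (M i i).re * (M j j).re := by
  have h := (hM.submatrix ![i, j]).det_nonneg
  have hs : M j i = star (M i j) := (hM.1.apply j i).symm
  rw [Matrix.det_fin_two] at h
  have h' := (Complex.nonneg_iff.1 h).1
  simp [hs, Matrix.PosSemidef.im_diag hM] at h'
  rw [Complex.normSq_apply]
  linarith

theorem idTensor_filtered {m : ℕ} (A : QubitOp) (Φ : QubitMap) (B : QubitOp)
    (M : Matrix (Fin m × Fin 2) (Fin m × Fin 2) ℂ) :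
    idTensor (filtered A Φ B) M = ((1 : Matrix (Fin m) (Fin m) ℂ) ⊗ₖ B) *
      idTensor Φ (((1 : Matrix (Fin m) (Fin m) ℂ) ⊗ₖ A) * M *
        ((1 : Matrix (Fin m) (Fin m) ℂ) ⊗ₖ A)ᴴ) * ((1 : Matrix (Fin m) (Fin m) ℂ) ⊗ₖ B)ᴴ := by
  have key : ∀ (C : QubitOp) (N : Matrix (Fin m × Fin 2) (Fin m × Fin 2) ℂ) (a b : Fin m)
      (k l : Fin 2), (((1 : Matrix (Fin m) (Fin m) ℂ) ⊗ₖ C) * N *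
        ((1 : Matrix (Fin m) (Fin m) ℂ) ⊗ₖ C)ᴴ) (a, k) (b, l)
        = (C * (Matrix.of fun k l => N (a, k) (b, l)) * Cᴴ) k l := by
    intro C N a b k l
    simp [Matrix.mul_apply, Fintype.sum_prod_type, Matrix.one_apply, apply_ite (starRingEnd ℂ)]
  ext ⟨a, k⟩ ⟨b, l⟩
  rw [key]
  simp only [idTensor, filtered_apply, Matrix.of_apply, key]
  rfl

theorem IsCompletelyPositive.filtered {Φ : QubitMap} (h : IsCompletelyPositive Φ) (A B : QubitOp) :
    IsCompletelyPositive (filtered A Φ B) := by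
  intro m M hM
  rw [idTensor_filtered]
  exact (h m _ (hM.mul_mul_conjTranspose_same _)).mul_mul_conjTranspose_same _

theorem IsCompletelyPositive.map_posSemidef {Φ : QubitMap} (h : IsCompletelyPositive Φ)
    {X : QubitOp} (hX : X.PosSemidef) : (Φ X).PosSemidef :=
  (h 1 _ (hX.submatrix Prod.snd)).submatrix fun k => (0, k)

theorem dualState_apply (Φ : QubitMap) (a b k l : Fin 2) :
    dualState Φ (a, k) (b, l) = Φ (Matrix.single a b 1) k l := by
  have hs : (Matrix.of fun k l : Fin 2 =>
      Matrix.vecMulVec maxEntangled (star maxEntangled) (a, k) (b, l))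
      = Matrix.single a b (1 : ℂ) := by
    ext k l
    fin_cases a <;> fin_cases b <;> fin_cases k <;> fin_cases l <;>
      simp [maxEntangled, Matrix.vecMulVec]
  rw [dualState, idTensor, Matrix.of_apply, hs]

theorem IsCompletelyPositive.dualState_posSemidef {Φ : QubitMap} (h : IsCompletelyPositive Φ) :
    (dualState Φ).PosSemidef :=
  h 2 _ (Matrix.posSemidef_vecMulVec_self_star _)

/-- The Cauchy–Schwarz inequalities satisfied by the blocks `Φ(|a⟩⟨b|)` of the dual state. -/
theorem IsCompletelyPositive.normSq_single_le {Φ : QubitMap} (h : IsCompletelyPositive Φ)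
    (a b k l : Fin 2) :
    Complex.normSq (Φ (Matrix.single a b 1) k l)
      ≤ (Φ (Matrix.single a a 1) k k).re * (Φ (Matrix.single b b 1) l l).re := by
  have := Matrix.PosSemidef.normSq_le h.dualState_posSemidef (a, k) (b, l)
  simpa only [dualState_apply] using this

theorem matrix_eq_sum_single_fin_two (X : QubitOp) : X = X 0 0 • Matrix.single 0 0 (1 : ℂ)
    + X 0 1 • Matrix.single 0 1 1 + X 1 0 • Matrix.single 1 0 1 + X 1 1 • Matrix.single 1 1 1 := by
  ext a b
  fin_cases a <;> fin_cases b <;> simp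

theorem IsCompletelyPositive.map_single {Φ : QubitMap} (h : IsCompletelyPositive Φ)
    (a b : Fin 2) : Φ (Matrix.single a b 1) = (Φ (Matrix.single b a 1))ᴴ := by
  ext k l
  rw [Matrix.conjTranspose_apply, ← dualState_apply, ← dualState_apply]
  exact (h.dualState_posSemidef.1.apply _ _).symm

theorem IsCompletelyPositive.map_conjTranspose {Φ : QubitMap} (h : IsCompletelyPositive Φ)
    (X : QubitOp) : Φ Xᴴ = (Φ X)ᴴ := by
  rw [matrix_eq_sum_single_fin_two X]
  simp only [Matrix.conjTranspose_add, Matrix.conjTranspose_smul, Matrix.conjTranspose_single,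
    map_add, map_smul, star_one]
  rw [h.map_single 0 0, h.map_single 0 1, h.map_single 1 0, h.map_single 1 1]
  simp only [Matrix.conjTranspose_conjTranspose]
  rw [← h.map_single 0 0, ← h.map_single 1 1]

theorem IsCompletelyPositive.exists_real_rMatrix {Φ : QubitMap} (h : IsCompletelyPositive Φ) :
    ∃ R : Matrix (Fin 4) (Fin 4) ℝ, rMatrix Φ = R.map Complex.ofReal := by
  refine ⟨Matrix.of fun i j => (rMatrix Φ i j).re, ?_⟩
  ext i j
  rw [Matrix.map_apply, Matrix.of_apply]
  refine (Complex.conj_eq_iff_re.1 ?_).symm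
  rw [rMatrix_apply, map_mul]
  congr 1
  · simp [map_ofNat]
  · change star _ = _
    rw [← Matrix.trace_conjTranspose, Matrix.conjTranspose_mul, ← h.map_conjTranspose,
      pauli_conjTranspose, pauli_conjTranspose, Matrix.trace_mul_comm]

/-- Complete positivity of a diagonal map confines its parameters to the tetrahedron of
Bell-diagonal states. -/
theorem diagParams_of_completelyPositive {Φ : QubitMap} (h : IsCompletelyPositive Φ)
    {c s₁ s₂ s₃ : ℝ} (hc : 0 < c)
    (hR : rMatrix Φ = (c • diagForm s₁ s₂ s₃).map Complex.ofReal) (h21 : s₂ ≤ s₁)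
    (h32 : |s₃| ≤ s₂) : DiagParams s₁ s₂ s₃ := by
  have e := eq_mapOfRMatrix hR
  have m1 := h.normSq_single_le 0 1 0 1
  have m2 := h.normSq_single_le 0 1 1 0
  have d1 := Matrix.PosSemidef.re_diag_nonneg h.dualState_posSemidef (0, 0)
  have d2 := Matrix.PosSemidef.re_diag_nonneg h.dualState_posSemidef (0, 1)
  rw [dualState_apply] at d1 d2
  have v : ∀ a b, Φ (Matrix.single a b 1)
      = ∑ i, ((1 / 2 : ℂ) * (c * (![1, s₁, s₂, s₃] i : ℝ)) * (pauli i) b a) • pauli i := by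
    intro a b
    rw [e, mapOfRMatrix_apply]
    refine Finset.sum_congr rfl fun i _ => ?_
    rw [← Finset.sum_smul]
    congr 1
    fin_cases i <;> fin_cases a <;> fin_cases b <;>
      simp [Fin.sum_univ_four, pauli, diagForm, Matrix.trace, Matrix.mul_apply, Fin.sum_univ_two]
  rw [v, v, v] at m1 m2
  rw [v] at d1 d2
  simp [Fin.sum_univ_four, pauli] at m1 m2 d1 d2
  have e1 : (2⁻¹ * ((c : ℂ) * s₁) + -(2⁻¹ * (c * s₂) * Complex.I * Complex.I))
      = ((c * (s₁ + s₂) / 2 : ℝ) : ℂ) := by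
    push_cast
    linear_combination -(2⁻¹ * (c : ℂ) * s₂) * Complex.I_sq
  have e2 : (2⁻¹ * ((c : ℂ) * s₁) + 2⁻¹ * (c * s₂) * Complex.I * Complex.I)
      = ((c * (s₁ - s₂) / 2 : ℝ) : ℂ) := by
    push_cast
    linear_combination (2⁻¹ * (c : ℂ) * s₂) * Complex.I_sq
  rw [e1, Complex.normSq_ofReal] at m1
  rw [e2, Complex.normSq_ofReal] at m2
  have g1 : 0 ≤ 1 + s₃ := nonneg_of_mul_nonneg_right (by linarith) hc
  have g2 : 0 ≤ 1 - s₃ := nonneg_of_mul_nonneg_right (by linarith) hc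
  have f1 := abs_le_of_sq_le_sq (a := c * (s₁ + s₂) / 2) (b := c * (1 + s₃) / 2) (by linarith)
    (by positivity)
  have f2 := abs_le_of_sq_le_sq (a := c * (s₁ - s₂) / 2) (b := c * (1 - s₃) / 2) (by linarith)
    (by positivity)
  have f3 : s₁ + s₂ ≤ 1 + s₃ := le_of_mul_le_mul_left (by linarith [(abs_le.1 f1).2]) hc
  have f4 : s₁ - s₂ ≤ 1 - s₃ := le_of_mul_le_mul_left (by linarith [(abs_le.1 f2).2]) hc
  exact ⟨by linarith, h21, h32, by linarith⟩

/-! ### The singular value decomposition with rotations -/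

/-- The rotations of three-dimensional space. -/
def rotations : Set (Matrix (Fin 3) (Fin 3) ℝ) := {O | Oᵀ * O = 1 ∧ O.det = 1}

theorem mul_mem_rotations {O P : Matrix (Fin 3) (Fin 3) ℝ} (hO : O ∈ rotations)
    (hP : P ∈ rotations) : O * P ∈ rotations := by
  refine ⟨?_, by rw [Matrix.det_mul, hO.2, hP.2, one_mul]⟩
  rw [Matrix.transpose_mul, Matrix.mul_assoc, ← Matrix.mul_assoc Oᵀ, hO.1, Matrix.one_mul, hP.1]

theorem isCompact_rotations : IsCompact rotations := by
  have hbox : IsCompact (Set.univ.pi fun _ : Fin 3 => Set.univ.pi fun _ : Fin 3 =>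
      Set.Icc (-1 : ℝ) 1) :=
    isCompact_univ_pi fun _ => isCompact_univ_pi fun _ => isCompact_Icc
  refine IsCompact.of_isClosed_subset (X := Matrix (Fin 3) (Fin 3) ℝ) hbox ?_ ?_
  · exact (isClosed_eq (continuous_id.matrix_transpose.matrix_mul continuous_id)
      continuous_const).inter (isClosed_eq continuous_id.matrix_det continuous_const)
  · rintro O ⟨hO, -⟩ i - j -
    have h : ∑ k, O k j * O k j = 1 := by
      have := congrFun (congrFun hO j) j
      simpa [Matrix.mul_apply] using this
    have h1 : O i j * O i j ≤ 1 := by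
      rw [← h]
      exact Finset.single_le_sum (f := fun k => O k j * O k j)
        (fun k _ => mul_self_nonneg _) (Finset.mem_univ i)
    exact abs_le.1 (abs_le_one_iff_mul_self_le_one.2 h1)

theorem rotation_zero_one {c s : ℝ} (h : c ^ 2 + s ^ 2 = 1) :
    !![c, -s, 0; s, c, 0; 0, 0, 1] ∈ rotations := by
  refine ⟨?_, by simp [Matrix.det_fin_three]; linarith⟩
  ext i j
  fin_cases i <;> fin_cases j <;> simp [Matrix.mul_apply, Fin.sum_univ_three] <;> linarith

theorem rotation_zero_two {c s : ℝ} (h : c ^ 2 + s ^ 2 = 1) :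
    !![c, 0, -s; 0, 1, 0; s, 0, c] ∈ rotations := by
  refine ⟨?_, by simp [Matrix.det_fin_three]; linarith⟩
  ext i j
  fin_cases i <;> fin_cases j <;> simp [Matrix.mul_apply, Fin.sum_univ_three] <;> linarith

theorem rotation_one_two {c s : ℝ} (h : c ^ 2 + s ^ 2 = 1) :
    !![1, 0, 0; 0, c, -s; 0, s, c] ∈ rotations := by
  refine ⟨?_, by simp [Matrix.det_fin_three]; linarith⟩
  ext i j
  fin_cases i <;> fin_cases j <;> simp [Matrix.mul_apply, Fin.sum_univ_three] <;> linarith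

/-- A function `a cos θ + b sin θ` with its maximum at `θ = 0` has `b = 0`. -/
theorem eq_zero_of_forall_circle_le {a b : ℝ}
    (h : ∀ c s : ℝ, c ^ 2 + s ^ 2 = 1 → a * c + b * s ≤ a) : b = 0 := by
  by_contra hb
  have hr : 0 < a ^ 2 + b ^ 2 := by positivity
  have hr' := Real.sqrt_pos.2 hr
  have hrr := Real.sq_sqrt hr.le
  set r := √(a ^ 2 + b ^ 2)
  have h1 := h (a / r) (b / r) (by field_simp; linarith)
  have h2 : a * (a / r) + b * (b / r) = r := by
    field_simp
    linarith
  rw [h2] at h1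
  have : 0 < b ^ 2 := by positivity
  nlinarith

/-- The ordered singular value decomposition with proper rotations. Among the matrices `O₁ T O₂`
take one maximizing `3 M₀₀ + 2 M₁₁ + M₂₂`. Comparison with `G M` and `M G` for plane rotations `G`
shows that it is diagonal, since the weights are distinct and positive; comparison with `G M G` and
`G M Gᵀ` for quarter turns `G` gives the order of the diagonal entries. -/
theorem exists_rotations_diagonal (T : Matrix (Fin 3) (Fin 3) ℝ) :
    ∃ O₁ ∈ rotations, ∃ O₂ ∈ rotations, ∃ s₁ s₂ s₃ : ℝ, s₂ ≤ s₁ ∧ |s₃| ≤ s₂ ∧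
      O₁ * T * O₂ = !![s₁, 0, 0; 0, s₂, 0; 0, 0, s₃] := by
  let f : Matrix (Fin 3) (Fin 3) ℝ → ℝ := fun M => 3 * M 0 0 + 2 * M 1 1 + M 2 2
  have hf : Continuous f := by
    have := fun i j : Fin 3 => (continuous_id (X := Matrix (Fin 3) (Fin 3) ℝ)).matrix_elem i j
    exact ((continuous_const.mul (this 0 0)).add (continuous_const.mul (this 1 1))).add (this 2 2)
  have h1 : (1 : Matrix (Fin 3) (Fin 3) ℝ) ∈ rotations := ⟨by simp, by simp⟩
  obtain ⟨⟨O₁, O₂⟩, ⟨hO₁, hO₂⟩, hmax⟩ :=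
    (isCompact_rotations.prod isCompact_rotations).exists_isMaxOn
    ⟨(1, 1), h1, h1⟩ (f := fun p => f (p.1 * T * p.2))
    (hf.comp ((continuous_fst.matrix_mul continuous_const).matrix_mul
      continuous_snd)).continuousOn
  have hm : ∀ G ∈ rotations, ∀ H ∈ rotations, f (G * (O₁ * T * O₂) * H) ≤ f (O₁ * T * O₂) := by
    intro G hG H hH
    have := hmax (a := (G * O₁, O₂ * H)) ⟨mul_mem_rotations hG hO₁, mul_mem_rotations hO₂ hH⟩
    simpa only [Set.mem_ofPred_eq, Matrix.mul_assoc] using this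
  refine ⟨O₁, hO₁, O₂, hO₂, ?_⟩
  generalize O₁ * T * O₂ = M at hm
  have l01 : 2 * M 0 1 - 3 * M 1 0 = 0 := eq_zero_of_forall_circle_le
    (a := 3 * M 0 0 + 2 * M 1 1) fun c s h => by
      have := hm _ (rotation_zero_one h) _ h1
      simp only [f, Matrix.mul_apply, Fin.sum_univ_three] at this
      simp at this
      linarith
  have r01 : 3 * M 0 1 - 2 * M 1 0 = 0 := eq_zero_of_forall_circle_le
    (a := 3 * M 0 0 + 2 * M 1 1) fun c s h => by
      have := hm _ h1 _ (rotation_zero_one h)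
      simp only [f, Matrix.mul_apply, Fin.sum_univ_three] at this
      simp at this
      linarith
  have l02 : M 0 2 - 3 * M 2 0 = 0 := eq_zero_of_forall_circle_le
    (a := 3 * M 0 0 + M 2 2) fun c s h => by
      have := hm _ (rotation_zero_two h) _ h1
      simp only [f, Matrix.mul_apply, Fin.sum_univ_three] at this
      simp at this
      linarith
  have r02 : 3 * M 0 2 - M 2 0 = 0 := eq_zero_of_forall_circle_le
    (a := 3 * M 0 0 + M 2 2) fun c s h => by
      have := hm _ h1 _ (rotation_zero_two h)
      simp only [f, Matrix.mul_apply, Fin.sum_univ_three] at this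
      simp at this
      linarith
  have l12 : M 1 2 - 2 * M 2 1 = 0 := eq_zero_of_forall_circle_le
    (a := 2 * M 1 1 + M 2 2) fun c s h => by
      have := hm _ (rotation_one_two h) _ h1
      simp only [f, Matrix.mul_apply, Fin.sum_univ_three] at this
      simp at this
      linarith
  have r12 : 2 * M 1 2 - M 2 1 = 0 := eq_zero_of_forall_circle_le
    (a := 2 * M 1 1 + M 2 2) fun c s h => by
      have := hm _ h1 _ (rotation_one_two h)
      simp only [f, Matrix.mul_apply, Fin.sum_univ_three] at this
      simp at this
      linarith
  have q : (0 : ℝ) ^ 2 + 1 ^ 2 = 1 := by norm_num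
  have q' : (0 : ℝ) ^ 2 + (-1) ^ 2 = 1 := by norm_num
  have o1 := hm _ (rotation_zero_one q) _ (rotation_zero_one q')
  have o2 := hm _ (rotation_one_two q) _ (rotation_one_two q)
  have o3 := hm _ (rotation_one_two q) _ (rotation_one_two q')
  simp only [f, Matrix.mul_apply, Fin.sum_univ_three] at o1 o2 o3
  simp at o1 o2 o3
  refine ⟨M 0 0, M 1 1, M 2 2, by linarith, abs_le.2 ⟨by linarith, by linarith⟩, ?_⟩
  ext i j
  fin_cases i <;> fin_cases j <;> simp <;> linarith

/-- A matrix acting on the spatial coordinates, with the time coordinate fixed. -/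
def spatial (O : Matrix (Fin 3) (Fin 3) ℝ) : Matrix (Fin 4) (Fin 4) ℝ :=
  !![1, 0, 0, 0; 0, O 0 0, O 0 1, O 0 2; 0, O 1 0, O 1 1, O 1 2; 0, O 2 0, O 2 1, O 2 2]

theorem spatial_mul (O P : Matrix (Fin 3) (Fin 3) ℝ) :
    spatial (O * P) = spatial O * spatial P := by
  ext i j
  fin_cases i <;> fin_cases j <;>
    simp [spatial, Matrix.mul_apply, Fin.sum_univ_three, Fin.sum_univ_four]

theorem isLorentz_spatial {O : Matrix (Fin 3) (Fin 3) ℝ} (hO : O ∈ rotations) :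
    IsLorentz (spatial O) := by
  refine ⟨?_, ?_, by simp [spatial]⟩
  · have h1 : (spatial O)ᵀ = spatial Oᵀ := by
      ext i j
      fin_cases i <;> fin_cases j <;> simp [spatial]
    have h2 : spatial Oᵀ * minkowski = minkowski * spatial Oᵀ := by
      ext i j
      fin_cases i <;> fin_cases j <;> simp [spatial, minkowski]
    have h3 : spatial 1 = 1 := by
      ext i j
      fin_cases i <;> fin_cases j <;> simp [spatial]
    rw [h1, h2, Matrix.mul_assoc, ← spatial_mul, hO.1, h3, Matrix.mul_one]
  · rw [← hO.2, Matrix.det_fin_three, spatial]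
    simp [Matrix.det_succ_row_zero, Fin.sum_univ_succ, Fin.succAbove]
    ring

/-- A completely positive map which fixes the identity up to a factor and maps traceless matrices to
traceless ones has a normal form of the first kind. -/
theorem exists_diag_of_block {Φ : QubitMap} (hΦ : IsCompletelyPositive Φ) {c : ℝ} (hc : 0 < c)
    {T : Matrix (Fin 3) (Fin 3) ℝ} (hR : rMatrix Φ = (c • spatial T).map Complex.ofReal) :
    ∃ s₁ s₂ s₃, DiagParams s₁ s₂ s₃ ∧ HasNormalForm Φ (diagForm s₁ s₂ s₃) := by
  obtain ⟨O₁, h1, O₂, h2, s₁, s₂, s₃, h21, h32, hd⟩ := exists_rotations_diagonal T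
  obtain ⟨B, hB⟩ := exists_lorentzOf_eq (isLorentz_spatial h1)
  obtain ⟨A, hA⟩ := exists_lorentzOf_eq (isLorentz_spatial h2)
  have e : rMatrix (filtered A.val Φ B.val) = (c • diagForm s₁ s₂ s₃).map Complex.ofReal := by
    rw [rMatrix_filtered, hR, hA, hB, ← map_ofReal_mul, ← map_ofReal_mul, Matrix.mul_smul,
      Matrix.smul_mul, ← spatial_mul, ← spatial_mul, hd]
    congr 2
  refine ⟨s₁, s₂, s₃, diagParams_of_completelyPositive (hΦ.filtered _ _) hc e h21 h32, ?_⟩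
  refine HasNormalForm.of_filtered (A := A.val) (B := B.val) (by simp [A.2]) (by simp [B.2])
    ⟨c, hc, 1, 1, ?_⟩
  rw [hasNormalFormVia_iff, e, lorentzOf_one, Matrix.one_mul, Matrix.mul_one]

/-! ### Channels sending some pure state to a pure state -/

/-- A completely positive map that fixes the pure state `|0⟩⟨0|` and maps `|0⟩⟨1|` to a multiple of
itself, in matrix entries. -/
theorem apply_eq_of_single {Φ : QubitMap} (h : IsCompletelyPositive Φ) {m b n d : ℂ}
    (h00 : Φ (Matrix.single 0 0 1) = !![1, 0; 0, 0])
    (h01 : Φ (Matrix.single 0 1 1) = !![0, m; 0, 0])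
    (h11 : Φ (Matrix.single 1 1 1) = !![b, n; star n, d]) (X : QubitOp) :
    Φ X = !![X 0 0 + b * X 1 1, m * X 0 1 + n * X 1 1;
      star m * X 1 0 + star n * X 1 1, d * X 1 1] := by
  conv_lhs => rw [matrix_eq_sum_single_fin_two X]
  simp only [map_add, map_smul]
  rw [h.map_single 1 0, h00, h01, h11]
  ext i j
  fin_cases i <;> fin_cases j <;> simp <;> ring

theorem mapOfRMatrix_nonDiagForm (c x : ℝ) (X : QubitOp) :
    mapOfRMatrix ((c • nonDiagForm x).map Complex.ofReal) X
      = !![c * (X 0 0 + 2 / 3 * X 1 1), c * ((x / √3 : ℝ) : ℂ) * X 0 1;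
        c * ((x / √3 : ℝ) : ℂ) * X 1 0, c * (1 / 3) * X 1 1] := by
  rw [mapOfRMatrix_apply]
  simp only [nonDiagForm]
  generalize x / √3 = y
  ext i j
  fin_cases i <;> fin_cases j <;>
    simp [Fin.sum_univ_four, pauli, Matrix.trace, Matrix.mul_apply, Fin.sum_univ_two]
  · ring
  · linear_combination (c * y / 2 * (X 1 0 - X 0 1) : ℂ) * Complex.I_sq
  · linear_combination (c * y / 2 * (X 0 1 - X 1 0) : ℂ) * Complex.I_sq
  · ring

/-- Here scaling the output basis makes the map fix the identity up to a factor. -/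
theorem exists_normalForm_of_triangular_zero {Φ : QubitMap} (h : IsCompletelyPositive Φ) {m : ℂ}
    {d : ℝ} (hd : 0 < d) (h00 : Φ (Matrix.single 0 0 1) = !![1, 0; 0, 0])
    (h01 : Φ (Matrix.single 0 1 1) = !![0, m; 0, 0])
    (h11 : Φ (Matrix.single 1 1 1) = !![0, 0; 0, (d : ℂ)]) :
    ∃ N, IsNormalForm N ∧ HasNormalForm Φ N := by
  set q := √d with hq
  have hq0 : 0 < q := Real.sqrt_pos.2 hd
  set t := √q with ht
  have ht0 : 0 < t := Real.sqrt_pos.2 hq0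
  have htt : (t : ℂ) * t = q := by exact_mod_cast Real.mul_self_sqrt hq0.le
  have hqq : (q : ℂ) * q = d := by exact_mod_cast Real.mul_self_sqrt hd.le
  have htc : (t : ℂ) ≠ 0 := by exact_mod_cast ht0.ne'
  have hqc : (q : ℂ) ≠ 0 := by exact_mod_cast hq0.ne'
  have hX := apply_eq_of_single h (n := 0) h00 h01 (by simpa using h11)
  set B : QubitOp := !![(t : ℂ), 0; 0, (t : ℂ)⁻¹] with hB
  have hBd : B.det ≠ 0 := by
    rw [hB, Matrix.det_fin_two_of]
    simp [htc]
  have hBt : Bᴴ = B := by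
    ext i j
    fin_cases i <;> fin_cases j <;> simp [hB]
  have hF : ∀ X, filtered 1 Φ B X = !![q * X 0 0, m * X 0 1; star m * X 1 0, q * X 1 1] := by
    intro X
    rw [filtered_apply, hBt, Matrix.one_mul, Matrix.conjTranspose_one, Matrix.mul_one, hX, hB,
      Matrix.mul_fin_two, Matrix.mul_fin_two]
    ext i j
    fin_cases i <;> fin_cases j <;> simp
    · linear_combination X 0 0 * htt
    · field_simp
    · field_simp
    · field_simp
      linear_combination -X 1 1 * hqq - X 1 1 * q * htt
  have hR : rMatrix (filtered 1 Φ B) = (q • spatial !![m.re / q, m.im / q, 0;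
      -m.im / q, m.re / q, 0; 0, 0, 1]).map Complex.ofReal := by
    have e1 : m = m.re + m.im * Complex.I := (Complex.re_add_im m).symm
    have e2 : starRingEnd ℂ m = m.re - m.im * Complex.I := by
      apply Complex.ext <;> simp
    ext i j
    rw [rMatrix_apply, hF]
    fin_cases i <;> fin_cases j <;>
      simp [pauli, spatial, Matrix.trace, Fin.sum_univ_two]
    · ring
    · rw [mul_div_cancel₀ _ hqc]
      linear_combination (1 / 2) * (e1 + e2)
    · rw [mul_div_cancel₀ _ hqc]
      linear_combination (1 / 2) * Complex.I * (e2 - e1) - m.im * Complex.I_sq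
    · rw [mul_div_cancel₀ _ hqc]
      linear_combination (1 / 2) * Complex.I * (e1 - e2) + m.im * Complex.I_sq
    · rw [mul_div_cancel₀ _ hqc]
      linear_combination -(1 / 2) * Complex.I ^ 2 * (e1 + e2) - m.re * Complex.I_sq
    · ring
  obtain ⟨s₁, s₂, s₃, hs, hn⟩ := exists_diag_of_block (h.filtered 1 B) hq0 hR
  exact ⟨_, Or.inl ⟨s₁, s₂, s₃, hs, rfl⟩, hn.of_filtered (by simp) hBd⟩

/-- Here diagonal filtering operations lead to the second normal form, with `x = |m| / √d`. -/
theorem exists_normalForm_of_triangular_pos {Φ : QubitMap} (h : IsCompletelyPositive Φ) {m : ℂ}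
    {b d : ℝ} (hb : 0 < b) (hd : 0 < d) (hm : Complex.normSq m ≤ d)
    (h00 : Φ (Matrix.single 0 0 1) = !![1, 0; 0, 0])
    (h01 : Φ (Matrix.single 0 1 1) = !![0, m; 0, 0])
    (h11 : Φ (Matrix.single 1 1 1) = !![(b : ℂ), 0; 0, (d : ℂ)]) :
    ∃ N, IsNormalForm N ∧ HasNormalForm Φ N := by
  have hX := apply_eq_of_single h (n := 0) h00 h01 (by simpa using h11)
  obtain ⟨w, hw⟩ : ∃ w : ℂ, w * star w = 1 ∧ ((‖m‖ : ℝ) : ℂ) * w = m := by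
    rcases eq_or_ne m 0 with rfl | h0
    · exact ⟨1, by simp, by simp⟩
    · have : ((‖m‖ : ℝ) : ℂ) ≠ 0 := by exact_mod_cast (norm_pos_iff.2 h0).ne'
      refine ⟨m / (‖m‖ : ℝ), ?_, by field_simp⟩
      rw [star_div₀, div_mul_div_comm]
      simp only [RCLike.star_def, Complex.conj_ofReal, Complex.mul_conj,
        Complex.normSq_eq_norm_sq]
      push_cast
      field_simp
  -- the scalings `u`, `v` of the two bases and the constant `c` solve
  -- `u² v² c = 1`, `2 = 3 b u⁴`, `c² = 3 d`
  set u2 := √(2 / (3 * b)) with hu2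
  set v2 := √(b / (2 * d)) with hv2
  set c := √(3 * d) with hc
  have hu20 : 0 < u2 := Real.sqrt_pos.2 (by positivity)
  have hv20 : 0 < v2 := Real.sqrt_pos.2 (by positivity)
  have hc0 : 0 < c := Real.sqrt_pos.2 (by positivity)
  have hu4 : u2 ^ 2 = 2 / (3 * b) := Real.sq_sqrt (by positivity)
  have hv4 : v2 ^ 2 = b / (2 * d) := Real.sq_sqrt (by positivity)
  have hcc : c ^ 2 = 3 * d := Real.sq_sqrt (by positivity)
  have huvc : u2 * v2 * c = 1 := by
    refine (pow_eq_one_iff_of_nonneg (by positivity) two_ne_zero).1 ?_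
    rw [mul_pow, mul_pow, hu4, hv4, hcc]
    field_simp
  set u := √u2 with hu
  set v := √v2 with hv
  have hu0 : 0 < u := Real.sqrt_pos.2 hu20
  have hv0 : 0 < v := Real.sqrt_pos.2 hv20
  have huu : u ^ 2 = u2 := Real.sq_sqrt hu20.le
  have hvv : v ^ 2 = v2 := Real.sq_sqrt hv20.le
  set x := ‖m‖ / √d with hx
  have hsd : 0 < √d := Real.sqrt_pos.2 hd
  have hx1 : x ≤ 1 := by
    rw [hx, div_le_one hsd]
    apply Real.le_sqrt_of_sq_le
    rwa [← Complex.normSq_eq_norm_sq]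
  have hx0 : 0 ≤ x := by positivity
  have hcx : c * (x / √3) = ‖m‖ := by
    rw [hc, Real.sqrt_mul (by norm_num), hx]
    have h3 : √3 ≠ 0 := (Real.sqrt_pos.2 (by norm_num)).ne'
    field_simp
  set A : QubitOp := !![(u : ℂ), 0; 0, (u : ℂ)⁻¹] with hA
  set B : QubitOp := !![(v : ℂ) * w, 0; 0, (v : ℂ)⁻¹] with hB
  have huc : (u : ℂ) ≠ 0 := by exact_mod_cast hu0.ne'
  have hvc : (v : ℂ) ≠ 0 := by exact_mod_cast hv0.ne'
  have hw0 : w ≠ 0 := by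
    rintro rfl
    simp at hw
  have key : Φ = filtered A (mapOfRMatrix ((c • nonDiagForm x).map Complex.ofReal)) B := by
    have hAt : Aᴴ = A := by
      ext i j
      fin_cases i <;> fin_cases j <;> simp [hA]
    have hBt : Bᴴ = !![(v : ℂ) * star w, 0; 0, (v : ℂ)⁻¹] := by
      ext i j
      fin_cases i <;> fin_cases j <;> simp [hB, mul_comm]
    ext1 X
    rw [filtered_apply, hAt, hBt, mapOfRMatrix_nonDiagForm, hX, hA, hB]
    have f1 : (u : ℂ) ^ 2 * v ^ 2 * c = 1 := by
      rw [← huu, ← hvv] at huvc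
      exact_mod_cast huvc
    have f2 : (3 : ℂ) * b * u ^ 4 = 2 := by
      have : 3 * b * u ^ 4 = 2 := by
        rw [show u ^ 4 = (u ^ 2) ^ 2 by ring, huu, hu4]
        field_simp
      exact_mod_cast this
    have f3 : (c : ℂ) ^ 2 = 3 * d := by exact_mod_cast hcc
    have f4 : (c : ℂ) * ((x / √3 : ℝ) : ℂ) = (‖m‖ : ℝ) := by exact_mod_cast hcx
    rw [f4]
    have f5 : star m = ((‖m‖ : ℝ) : ℂ) * star w := by
      calc star m = star (((‖m‖ : ℝ) : ℂ) * w) := by rw [hw.2]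
        _ = _ := by simp
    obtain ⟨hww, hwm⟩ := hw
    simp only [RCLike.star_def] at f5 hww
    have k1 : (u : ℂ) * (u : ℂ)⁻¹ = 1 := mul_inv_cancel₀ huc
    have k2 : (v : ℂ) * (v : ℂ)⁻¹ = 1 := mul_inv_cancel₀ hvc
    have g1 : (c : ℂ) * v ^ 2 = (u : ℂ)⁻¹ ^ 2 := by
      field_simp
      linear_combination f1
    have g3 : (2 / 3 : ℂ) * (u : ℂ)⁻¹ ^ 4 = b := by
      field_simp
      linear_combination -f2
    have g4 : (u : ℂ)⁻¹ ^ 2 * (v : ℂ)⁻¹ ^ 2 = c := by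
      field_simp
      linear_combination -f1
    generalize (u : ℂ)⁻¹ = U at *
    generalize (v : ℂ)⁻¹ = V at *
    ext i j
    fin_cases i <;> fin_cases j <;> simp [Matrix.mul_apply, Fin.sum_univ_two, Matrix.vecMul,
      Matrix.vecHead, Matrix.vecTail]
    · linear_combination -(c * v ^ 2 * (u ^ 2 * X 0 0 + 2 / 3 * U ^ 2 * X 1 1)) * hww
        - (u ^ 2 * X 0 0 + 2 / 3 * U ^ 2 * X 1 1) * g1 - X 0 0 * (u * U + 1) * k1 - X 1 1 * g3
    · linear_combination -X 0 1 * hwm - ((‖m‖ : ℝ) : ℂ) * w * X 0 1 * (k2 + v * V * k1)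
    · linear_combination X 1 0 * f5
        - ((‖m‖ : ℝ) : ℂ) * starRingEnd ℂ w * X 1 0 * (k2 + v * V * k1)
    · linear_combination -(c / 3 * X 1 1) * g4 - X 1 1 / 3 * f3
  rw [key]
  refine ⟨_, Or.inr (Or.inl ⟨x, hx0, hx1, rfl⟩), HasNormalForm.to_filtered ⟨c, hc0, 1, 1, ?_⟩ ?_ ?_⟩
  · rw [hasNormalFormVia_iff, rMatrix_mapOfRMatrix, lorentzOf_one, Matrix.one_mul, Matrix.mul_one]
  · rw [hA, Matrix.det_fin_two_of]
    simp [huc]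
  · rw [hB, Matrix.det_fin_two_of]
    simp [hvc, hw0]

/-- If a channel fixes the pure state `|0⟩⟨0|`, triangular filtering operations remove the
off-diagonal part of `Φ(|1⟩⟨1|)`. -/
theorem exists_normalForm_of_fixed_pure {Φ : QubitMap} (hΦ : IsQubitChannel Φ)
    (h00 : Φ (Matrix.single 0 0 1) = !![1, 0; 0, 0]) :
    ∃ N, IsNormalForm N ∧ HasNormalForm Φ N := by
  obtain ⟨h, htp⟩ := hΦ
  set m := Φ (Matrix.single 0 1 1) 0 1 with hm
  set n := Φ (Matrix.single 1 1 1) 0 1 with hn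
  set b := (Φ (Matrix.single 1 1 1) 0 0).re with hb
  set d := (Φ (Matrix.single 1 1 1) 1 1).re with hd
  have p11 : (Φ (Matrix.single 1 1 1)).PosSemidef := h.map_posSemidef (posSemidef_single 1)
  have h11 : Φ (Matrix.single 1 1 1) = !![(b : ℂ), n; star n, (d : ℂ)] := by
    ext i j
    fin_cases i <;> fin_cases j
    · exact Complex.ext rfl (by simpa using Matrix.PosSemidef.im_diag p11 0)
    · rfl
    · exact (p11.1.apply 1 0).symm
    · exact Complex.ext rfl (by simpa using Matrix.PosSemidef.im_diag p11 1)
  have hbd : b + d = 1 := by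
    have := htp (Matrix.single 1 1 1)
    rw [h11, Matrix.trace_fin_two_of] at this
    have := congrArg Complex.re this
    simpa [Matrix.trace, Fin.sum_univ_two] using this
  have hb0 : 0 ≤ b := Matrix.PosSemidef.re_diag_nonneg p11 0
  have hd0 : 0 ≤ d := Matrix.PosSemidef.re_diag_nonneg p11 1
  have z10 : Φ (Matrix.single 0 1 1) 1 0 = 0 := by
    have := h.normSq_single_le 0 1 1 0
    rw [h00] at this
    simpa using this.antisymm (by simpa using Complex.normSq_nonneg _)
  have z11 : Φ (Matrix.single 0 1 1) 1 1 = 0 := by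
    have := h.normSq_single_le 0 1 1 1
    rw [h00] at this
    simpa using this.antisymm (by simpa using Complex.normSq_nonneg _)
  have z00 : Φ (Matrix.single 0 1 1) 0 0 = 0 := by
    have := htp (Matrix.single 0 1 1)
    rw [Matrix.trace_fin_two, z11, add_zero] at this
    rw [this]
    simp [Matrix.trace]
  have h01 : Φ (Matrix.single 0 1 1) = !![0, m; 0, 0] := by
    ext i j
    fin_cases i <;> fin_cases j
    · exact z00
    · rfl
    · exact z10
    · exact z11
  have hmd : Complex.normSq m ≤ d := by
    have := h.normSq_single_le 0 1 0 1
    rw [h00] at this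
    simpa using this
  have hX := apply_eq_of_single h h00 h01 h11
  rcases hd0.eq_or_lt with hd0 | hd0
  · have hm0 : m = 0 :=
      Complex.normSq_eq_zero.1 (le_antisymm (by rwa [hd0]) (Complex.normSq_nonneg _))
    have hn0 : n = 0 := by
      have := Matrix.PosSemidef.normSq_le p11 0 1
      refine Complex.normSq_eq_zero.1 (le_antisymm (this.trans ?_) (Complex.normSq_nonneg _))
      rw [← hd, ← hd0, mul_zero]
    have hb1 : b = 1 := by linarith
    refine ⟨constForm, Or.inr (Or.inr rfl), 1, one_pos, 1, 1, ?_⟩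
    rw [hasNormalFormVia_iff, lorentzOf_one, Matrix.one_mul, Matrix.mul_one, one_smul,
      ← rMatrix_mapOfRMatrix (constForm.map Complex.ofReal)]
    congr 1
    ext1 X
    rw [hX, mapOfRMatrix_constForm, hm0, hn0, hb1, ← hd0, Matrix.trace_fin_two]
    ext i j
    fin_cases i <;> fin_cases j <;> simp
  -- `z` is the shift of the input, `w` below that of the output; the equation for `z` makes the
  -- terms of `Φ` linear in the off-diagonal entry of the input cancel
  obtain ⟨z, hz⟩ : ∃ z : ℂ, d * z = star m * (m * z + n) := by
    rcases hmd.eq_or_lt with hmd | hmd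
    · -- in the degenerate case positivity at the vectors `(t m̄ n, 1)` forces `n = 0`
      suffices hn0 : n = 0 from ⟨0, by rw [hn0]; simp⟩
      by_contra hn0
      have hnn : 0 < Complex.normSq n := Complex.normSq_pos.2 hn0
      set t : ℝ := b / (2 * Complex.normSq n) with ht
      have hpos := h.map_posSemidef
        (Matrix.posSemidef_vecMulVec_self_star ![(t : ℂ) * star m * n, 1])
      have := Matrix.PosSemidef.normSq_le hpos 0 1
      rw [hX] at this
      have e1 : m * (t * star m * n) + n = ((t * d + 1 : ℝ) : ℂ) * n := by
        have : m * star m = (d : ℂ) := by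
          rw [← hmd]
          exact Complex.mul_conj m
        push_cast
        linear_combination t * n * this
      have e2 : (t * star m * n) * star (t * star m * n)
          = ((t ^ 2 * d * Complex.normSq n : ℝ) : ℂ) := by
        change _ * starRingEnd ℂ _ = _
        rw [Complex.mul_conj, map_mul, map_mul, Complex.normSq_ofReal, ← hmd]
        simp only [RCLike.star_def, Complex.normSq_conj]
        push_cast
        ring
      simp only [Matrix.vecMulVec_apply, Matrix.of_apply, Matrix.cons_val', Matrix.cons_val_zero,
        Matrix.cons_val_one, Matrix.cons_val_fin_one, Pi.star_apply, star_one, mul_one] at this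
      rw [e1, e2, map_mul, Complex.normSq_ofReal] at this
      simp only [← Complex.ofReal_add, Complex.ofReal_re] at this
      have ht2 : 2 * t * Complex.normSq n = b := by
        rw [ht]
        field_simp
      nlinarith
    · refine ⟨star m * n / ((d - Complex.normSq m : ℝ) : ℂ), ?_⟩
      have hne : ((d - Complex.normSq m : ℝ) : ℂ) ≠ 0 := by
        exact_mod_cast (sub_pos.2 hmd).ne'
      have hmm : star m * m = (Complex.normSq m : ℂ) := (Complex.normSq_eq_conj_mul_self).symm
      field_simp
      push_cast
      linear_combination (-star m * n) * hmm
  set w : ℂ := -(m * z + n) / d with hw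
  have hdc : (d : ℂ) ≠ 0 := by exact_mod_cast hd0.ne'
  have hwd : d * w = -(m * z + n) := by
    rw [hw]
    field_simp
  set S : QubitOp := !![1, z; 0, 1] with hS
  set W : QubitOp := !![1, w; 0, 1] with hW
  have hSd : S.det ≠ 0 := by simp [hS, Matrix.det_fin_two_of]
  have hWd : W.det ≠ 0 := by simp [hW, Matrix.det_fin_two_of]
  have hSt : Sᴴ = !![1, 0; star z, 1] := by
    ext i j
    fin_cases i <;> fin_cases j <;> simp [hS]
  have hWt : Wᴴ = !![1, 0; star w, 1] := by
    ext i j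
    fin_cases i <;> fin_cases j <;> simp [hW]
  have hc := h.filtered S W
  have hF : ∀ X, filtered S Φ W X = W * Φ (S * X * Sᴴ) * Wᴴ := fun X => rfl
  have hzw : z + star m * w = 0 := by
    apply mul_left_cancel₀ hdc
    linear_combination hz + star m * hwd
  have hzw' : star z + m * star w = 0 := by
    have := congrArg star hzw
    simpa [mul_comm] using this
  have hwd' : d * star w = -(star m * star z + star n) := by
    have := congrArg star hwd
    simpa [mul_comm] using this
  simp only [RCLike.star_def] at hwd'
  have k00 : filtered S Φ W (Matrix.single 0 0 1) = !![1, 0; 0, 0] := by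
    rw [hF, hX, hSt, hWt, hS, hW]
    ext i j
    fin_cases i <;> fin_cases j <;>
      simp [Matrix.mul_apply, Fin.sum_univ_two, Matrix.vecMul, Matrix.vecHead, Matrix.vecTail]
  have k01 : filtered S Φ W (Matrix.single 0 1 1) = !![0, m; 0, 0] := by
    rw [hF, hX, hSt, hWt, hS, hW]
    ext i j
    fin_cases i <;> fin_cases j <;>
      simp [Matrix.mul_apply, Fin.sum_univ_two, Matrix.vecMul, Matrix.vecHead, Matrix.vecTail]
    simpa using hzw'
  have k11 : (filtered S Φ W (Matrix.single 1 1 1)) 0 1 = 0 ∧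
      (filtered S Φ W (Matrix.single 1 1 1)) 1 0 = 0 ∧
      (filtered S Φ W (Matrix.single 1 1 1)) 1 1 = d := by
    rw [hF, hX, hSt, hWt, hS, hW]
    simp [Matrix.mul_apply, Fin.sum_univ_two, Matrix.vecMul, Matrix.vecHead, Matrix.vecTail]
    constructor
    · linear_combination hwd
    · linear_combination hwd'
  have q11 := hc.map_posSemidef (posSemidef_single 1)
  set e := (filtered S Φ W (Matrix.single 1 1 1) 0 0).re with he
  have k11' : filtered S Φ W (Matrix.single 1 1 1) = !![(e : ℂ), 0; 0, (d : ℂ)] := by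
    ext i j
    fin_cases i <;> fin_cases j
    · exact Complex.ext rfl (by simpa using Matrix.PosSemidef.im_diag q11 0)
    · exact k11.1
    · exact k11.2.1
    · exact k11.2.2
  have he0 : 0 ≤ e := Matrix.PosSemidef.re_diag_nonneg q11 0
  have hN : ∃ N, IsNormalForm N ∧ HasNormalForm (filtered S Φ W) N := by
    rcases he0.eq_or_lt with he0 | he0
    · rw [← he0, Complex.ofReal_zero] at k11'
      exact exists_normalForm_of_triangular_zero hc hd0 k00 k01 k11'
    · exact exists_normalForm_of_triangular_pos hc he0 hd0 hmd k00 k01 k11'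
  obtain ⟨N, hN, hNf⟩ := hN
  exact ⟨N, hN, hNf.of_filtered hSd hWd⟩

/-- The matrix with first column `f` which is unitary when `f` is a unit vector. -/
def frameOf (f : Fin 2 → ℂ) : QubitOp := !![f 0, -star (f 1); f 1, star (f 0)]

theorem frameOf_mul_conjTranspose {f : Fin 2 → ℂ} (hf : (Matrix.vecMulVec f (star f)).trace = 1) :
    frameOf f * (frameOf f)ᴴ = 1 := by
  simp [Matrix.trace, Fin.sum_univ_two, Matrix.vecMulVec_apply] at hf
  ext i j
  fin_cases i <;> fin_cases j <;> simp [frameOf, Matrix.mul_apply, Fin.sum_univ_two]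
  · linear_combination hf
  · ring
  · ring
  · linear_combination hf

theorem frameOf_conj_single (f : Fin 2 → ℂ) :
    frameOf f * Matrix.single 0 0 1 * (frameOf f)ᴴ = Matrix.vecMulVec f (star f) := by
  ext i j
  fin_cases i <;> fin_cases j <;>
    simp [frameOf, Matrix.mul_apply, Matrix.vecMul, dotProduct, Fin.sum_univ_two,
      Matrix.vecMulVec_apply]

theorem IsQubitChannel.filtered_unitary {Φ : QubitMap} (hΦ : IsQubitChannel Φ) {U V : QubitOp}
    (hU : U * Uᴴ = 1) (hV : V * Vᴴ = 1) : IsQubitChannel (filtered U Φ Vᴴ) := by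
  refine ⟨hΦ.1.filtered _ _, fun X => ?_⟩
  rw [filtered_apply, Matrix.trace_mul_comm, ← Matrix.mul_assoc, Matrix.conjTranspose_conjTranspose,
    hV, Matrix.one_mul, hΦ.2, Matrix.trace_mul_comm, ← Matrix.mul_assoc, mul_eq_one_comm.1 hU,
    Matrix.one_mul]

theorem Matrix.PosSemidef.eq_vecMulVec_of_det_eq_zero {P : QubitOp} (hP : P.PosSemidef)
    (hd : P.det = 0)
    (ht : P.trace = 1) : ∃ f : Fin 2 → ℂ, P = Matrix.vecMulVec f (star f) := by
  set p := (P 0 0).re with hp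
  set r := (P 1 1).re with hr
  have e00 : P 0 0 = p := Complex.ext rfl (by simpa using Matrix.PosSemidef.im_diag hP 0)
  have e11 : P 1 1 = r := Complex.ext rfl (by simpa using Matrix.PosSemidef.im_diag hP 1)
  have e10 : P 1 0 = star (P 0 1) := (hP.1.apply 1 0).symm
  have hpr : p + r = 1 := by
    rw [Matrix.trace_fin_two, e00, e11] at ht
    exact_mod_cast ht
  have hdet : p * r = (P 0 1).re ^ 2 + (P 0 1).im ^ 2 := by
    rw [Matrix.det_fin_two, e00, e11, e10] at hd
    have := congrArg Complex.re hd
    simp at this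
    linarith
  obtain ⟨f, hf⟩ := exists_spinor ![(p + r) / 2, (P 0 1).re, -(P 0 1).im, (p - r) / 2]
    (by simp [hpr]) (by simp; linear_combination hdet)
  refine ⟨f, ?_⟩
  rw [← hf, hermOf_eq]
  ext i j
  fin_cases i <;> fin_cases j
  · simp [e00]
    ring
  · simpa [mul_comm] using (Complex.re_add_im (P 0 1)).symm
  · simp only [Fin.mk_one, Fin.zero_eta, e10]
    apply Complex.ext <;> simp
  · simp [e11]
    ring

/-- Unitary filtering turns a pure state with a pure image into `|0⟩⟨0|`, with image `|0⟩⟨0|`. -/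
theorem exists_normalForm_of_pure {Φ : QubitMap} (hΦ : IsQubitChannel Φ) {f : Fin 2 → ℂ}
    (hf : f ≠ 0) (hd : (Φ (Matrix.vecMulVec f (star f))).det = 0) :
    ∃ N, IsNormalForm N ∧ HasNormalForm Φ N := by
  set n : ℝ := Complex.normSq (f 0) + Complex.normSq (f 1) with hn
  have hn0 : 0 < n := by
    have h0 := Complex.normSq_nonneg (f 0)
    have h1 := Complex.normSq_nonneg (f 1)
    refine lt_of_le_of_ne (by positivity) fun h => hf ?_
    have e0 : Complex.normSq (f 0) = 0 := by linarith
    have e1 : Complex.normSq (f 1) = 0 := by linarith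
    ext i
    fin_cases i
    · exact Complex.normSq_eq_zero.1 e0
    · exact Complex.normSq_eq_zero.1 e1
  -- the unit vector `g` spans the same line as `f`
  set s := √n
  have hs0 : 0 < s := Real.sqrt_pos.2 hn0
  have hss : (s : ℂ) * s = n := by exact_mod_cast Real.mul_self_sqrt hn0.le
  have hsc : (s : ℂ) ≠ 0 := by exact_mod_cast hs0.ne'
  have hnc : (n : ℂ) ≠ 0 := by exact_mod_cast hn0.ne'
  set g : Fin 2 → ℂ := (s : ℂ)⁻¹ • f with hg
  have hgf : Matrix.vecMulVec g (star g) = (n : ℂ)⁻¹ • Matrix.vecMulVec f (star f) := by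
    ext i j
    simp [hg, Matrix.vecMulVec_apply, ← hss]
    ring
  have hgt : (Matrix.vecMulVec g (star g)).trace = 1 := by
    rw [hgf, Matrix.trace_smul, Matrix.trace_fin_two, Matrix.vecMulVec_apply,
      Matrix.vecMulVec_apply, smul_eq_mul, Pi.star_apply, Pi.star_apply]
    simp only [RCLike.star_def, Complex.mul_conj]
    rw [← Complex.ofReal_add, ← hn, inv_mul_cancel₀ hnc]
  have hgd : (Φ (Matrix.vecMulVec g (star g))).det = 0 := by
    rw [hgf, map_smul, Matrix.det_smul, hd, mul_zero]
  obtain ⟨k, hk⟩ := Matrix.PosSemidef.eq_vecMulVec_of_det_eq_zero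
    (hΦ.1.map_posSemidef (Matrix.posSemidef_vecMulVec_self_star g)) hgd (by rw [hΦ.2, hgt])
  have hkt : (Matrix.vecMulVec k (star k)).trace = 1 := by rw [← hk, hΦ.2, hgt]
  have hU := frameOf_mul_conjTranspose hgt
  have hV := frameOf_mul_conjTranspose hkt
  have hV' := mul_eq_one_comm.1 hV
  obtain ⟨N, hN, hNf⟩ := exists_normalForm_of_fixed_pure (hΦ.filtered_unitary hU hV) (by
    rw [filtered_apply, frameOf_conj_single, hk, ← frameOf_conj_single,
      Matrix.conjTranspose_conjTranspose]
    calc (frameOf k)ᴴ * (frameOf k * Matrix.single 0 0 1 * (frameOf k)ᴴ) * frameOf k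
        = ((frameOf k)ᴴ * frameOf k) * Matrix.single 0 0 1 * ((frameOf k)ᴴ * frameOf k) := by
          simp only [Matrix.mul_assoc]
      _ = !![1, 0; 0, 0] := by
          rw [hV', Matrix.one_mul, Matrix.mul_one]
          ext i j
          fin_cases i <;> fin_cases j <;> simp)
  refine ⟨N, hN, hNf.of_filtered (fun h => ?_) (fun h => ?_)⟩
  · have := congrArg Matrix.det hU
    rw [Matrix.det_mul, h, zero_mul, Matrix.det_one] at this
    exact zero_ne_one this
  · have := congrArg Matrix.det hV
    rw [Matrix.det_mul, h, mul_zero, Matrix.det_one] at this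
    exact zero_ne_one this

/-! ### Channels sending no pure state to a pure state -/

theorem mul_conjTranspose_eq_sum_columns (S : QubitOp) :
    S * Sᴴ = Matrix.vecMulVec (fun i => S i 0) (star fun i => S i 0)
      + Matrix.vecMulVec (fun i => S i 1) (star fun i => S i 1) := by
  ext i j
  simp [Matrix.mul_apply, Fin.sum_univ_two, Matrix.vecMulVec_apply]

/-- A positive matrix `S S†` is a sum of pure states, one of which is nonzero and hence has a
positive definite image. -/
theorem posDef_map_of_no_pure {Φ : QubitMap} (h : IsCompletelyPositive Φ)
    (hp : ∀ f : Fin 2 → ℂ, f ≠ 0 → (Φ (Matrix.vecMulVec f (star f))).det ≠ 0) {S : QubitOp}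
    (hS : S ≠ 0) : (Φ (S * Sᴴ)).PosDef := by
  have hsd : ∀ f : Fin 2 → ℂ, (Φ (Matrix.vecMulVec f (star f))).PosSemidef := fun f =>
    h.map_posSemidef (Matrix.posSemidef_vecMulVec_self_star f)
  have hpd : ∀ f : Fin 2 → ℂ, f ≠ 0 → (Φ (Matrix.vecMulVec f (star f))).PosDef := fun f hf =>
    (hsd f).posDef_iff_det_ne_zero.2 (hp f hf)
  rw [mul_conjTranspose_eq_sum_columns, map_add]
  by_cases h0 : (fun i => S i 0) = 0
  · have h1 : (fun i => S i 1) ≠ 0 := by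
      intro h1
      apply hS
      ext i j
      fin_cases j
      · exact congrFun h0 i
      · exact congrFun h1 i
    exact Matrix.PosDef.posSemidef_add (hsd _) (hpd _ h1)
  · exact Matrix.PosDef.add_posSemidef (hpd _ h0) (hsd _)

theorem continuous_qubitMap (Φ : QubitMap) : Continuous Φ :=
  Φ.continuous_of_finiteDimensional

/-- The ratio `|det S|² / det Φ(S S†)` attains its maximum, at an invertible matrix: it is
continuous and homogeneous of degree zero. -/
theorem exists_maximizer {Φ : QubitMap}
    (hpos : ∀ S : QubitOp, S ≠ 0 → 0 < (Φ (S * Sᴴ)).det.re) :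
    ∃ S₀ : QubitOp, S₀.det ≠ 0 ∧ ∀ S : QubitOp, Complex.normSq S.det * (Φ (S₀ * S₀ᴴ)).det.re
      ≤ Complex.normSq S₀.det * (Φ (S * Sᴴ)).det.re := by
  let K : Set (Fin 2 → Fin 2 → ℂ) := Metric.sphere 0 1
  let D : (Fin 2 → Fin 2 → ℂ) → ℝ := fun S => (Φ (Matrix.of S * (Matrix.of S)ᴴ)).det.re
  let g : (Fin 2 → Fin 2 → ℂ) → ℝ := fun S => Complex.normSq (Matrix.of S).det
  have hD : Continuous D := by
    have h1 : Continuous fun S : QubitOp => S * Sᴴ :=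
      continuous_id.matrix_mul continuous_id.matrix_conjTranspose
    exact Complex.continuous_re.comp ((continuous_qubitMap Φ).comp h1).matrix_det
  have hg : Continuous g := Complex.continuous_normSq.comp
    (Continuous.matrix_det (A := fun S : QubitOp => S) continuous_id)
  have hscale : ∀ (r : ℝ) (S : Fin 2 → Fin 2 → ℂ), D ((r : ℂ) • S) = r ^ 4 * D S ∧
      g ((r : ℂ) • S) = r ^ 4 * g S := by
    intro r S
    have e : Matrix.of ((r : ℂ) • S) = (r : ℂ) • Matrix.of S := rfl
    constructor
    · simp only [D, e, Matrix.conjTranspose_smul, Matrix.smul_mul, Matrix.mul_smul, smul_smul,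
        map_smul, Matrix.det_smul, Fintype.card_fin, RCLike.star_def, Complex.conj_ofReal]
      rw [← Complex.ofReal_mul, ← Complex.ofReal_pow, Complex.re_ofReal_mul]
      ring
    · simp only [g, e, Matrix.det_smul, Fintype.card_fin, map_mul, map_pow, Complex.normSq_ofReal]
      ring
  have hDpos : ∀ S : Fin 2 → Fin 2 → ℂ, S ≠ 0 → 0 < D S := fun S hS => hpos S hS
  have hne : ∀ S ∈ K, S ≠ 0 := by
    rintro S hS rfl
    simp [K] at hS
  have hnorm : ∀ S : Fin 2 → Fin 2 → ℂ, S ≠ 0 → ((‖S‖⁻¹ : ℝ) : ℂ) • S ∈ K := by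
    intro S hS
    have : ‖S‖ ≠ 0 := norm_ne_zero_iff.2 hS
    simp [K, norm_smul, this]
  have h10 : (1 : QubitOp) ≠ 0 := one_ne_zero
  obtain ⟨S₀, hS₀, hmax⟩ := (isCompact_sphere (0 : Fin 2 → Fin 2 → ℂ) 1).exists_isMaxOn
    ⟨_, hnorm (1 : QubitOp) h10⟩ (f := fun S => g S / D S)
    (hg.continuousOn.div hD.continuousOn fun S hS => (hDpos S (hne S hS)).ne')
  have hD0 := hDpos S₀ (hne S₀ hS₀)
  have hle : ∀ S : Fin 2 → Fin 2 → ℂ, g S * D S₀ ≤ g S₀ * D S := by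
    intro S
    rcases eq_or_ne S 0 with rfl | hS
    · have h1 := hscale 0 0
      simp at h1
      rw [h1.1, h1.2]
      simp
    · have h1 := hmax (hnorm S hS)
      obtain ⟨h2, h3⟩ := hscale ‖S‖⁻¹ S
      have hr : 0 < ‖S‖⁻¹ ^ 4 := by
        have := norm_pos_iff.2 hS
        positivity
      simp only [Set.mem_ofPred_eq] at h1
      have h4 := mul_div_mul_left (g S) (D S) hr.ne'
      rw [← h2, ← h3] at h4
      rw [h4] at h1
      exact (div_le_div_iff₀ (hDpos S hS) hD0).1 h1
  refine ⟨Matrix.of S₀, fun h => ?_, fun S => hle (Matrix.of.symm S)⟩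
  have h1 := hle (Matrix.of.symm (1 : QubitOp))
  have h2 : g S₀ = 0 := by
    simp only [g, h, map_zero]
  have h3 : g (Matrix.of.symm (1 : QubitOp)) = 1 := by
    simp [g]
  rw [h2, h3] at h1
  linarith

/-- If `Ω` is unital and does not decrease the determinant of positive matrices, the first-order
condition at the identity says that it preserves the trace of the Pauli matrices. -/
theorem trace_map_pauli_eq_zero {Ω : QubitMap} (h1 : Ω 1 = 1)
    (h : ∀ S : QubitOp, Complex.normSq S.det ≤ (Ω (S * Sᴴ)).det.re) {j : Fin 4} (hj : j ≠ 0) :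
    (Ω (pauli j)).trace.re = 0 := by
  have hsq : pauli j * pauli j = 1 := by
    ext a b
    fin_cases j <;> fin_cases a <;> fin_cases b <;> simp [pauli]
  have hdet : ∀ u : ℂ, (1 + u • pauli j).det = 1 - u ^ 2 := by
    intro u
    fin_cases j
    · exact absurd rfl hj
    · simp [pauli, Matrix.det_fin_two]
      ring
    · simp [pauli, Matrix.det_fin_two]
      linear_combination u ^ 2 * Complex.I_sq
    · simp [pauli, Matrix.det_fin_two]
      ring
  set τ := (Ω (pauli j)).trace.re with hτ
  set e := (Ω (pauli j)).det.re with he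
  have key : ∀ u : ℝ, (1 - u ^ 2) ^ 2 ≤ (1 + u ^ 2) ^ 2 + 2 * u * (1 + u ^ 2) * τ
      + 4 * u ^ 2 * e := by
    intro u
    have h2 := h (1 + (u : ℂ) • pauli j)
    have h3 : (1 + (u : ℂ) • pauli j) * (1 + (u : ℂ) • pauli j)ᴴ
        = ((1 + u ^ 2 : ℝ) : ℂ) • 1 + ((2 * u : ℝ) : ℂ) • pauli j := by
      simp only [Matrix.conjTranspose_add, Matrix.conjTranspose_one, Matrix.conjTranspose_smul,
        pauli_conjTranspose, Matrix.mul_add, Matrix.add_mul, Matrix.mul_one, Matrix.one_mul,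
        Matrix.smul_mul, Matrix.mul_smul, hsq, RCLike.star_def, Complex.conj_ofReal]
      push_cast
      module
    rw [hdet, h3, map_add, map_smul, map_smul, h1] at h2
    have h4 : (((1 + u ^ 2 : ℝ) : ℂ) • (1 : QubitOp) + ((2 * u : ℝ) : ℂ) • Ω (pauli j)).det
        = ((1 + u ^ 2 : ℝ) : ℂ) ^ 2 + ((2 * u * (1 + u ^ 2) : ℝ) : ℂ) * (Ω (pauli j)).trace
          + ((4 * u ^ 2 : ℝ) : ℂ) * (Ω (pauli j)).det := by
      rw [Matrix.det_fin_two, Matrix.det_fin_two, Matrix.trace_fin_two]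
      simp
      ring
    rw [h4, Complex.add_re, Complex.add_re, Complex.re_ofReal_mul, Complex.re_ofReal_mul,
      ← Complex.ofReal_pow (1 + u ^ 2), Complex.ofReal_re, ← hτ, ← he] at h2
    have h5 : Complex.normSq (1 - (u : ℂ) ^ 2) = (1 - u ^ 2) ^ 2 := by
      rw [← Complex.ofReal_pow, ← Complex.ofReal_one, ← Complex.ofReal_sub, Complex.normSq_ofReal]
      ring
    rwa [h5] at h2
  by_contra hτ0
  have hττ : 0 < τ ^ 2 := by positivity
  set s : ℝ := 1 / (4 * (|1 + e| + 1)) with hs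
  have hs0 : 0 < s := by positivity
  have hse : s * (1 + e) ≤ 1 / 4 := by
    have h2 : 1 + e ≤ |1 + e| := le_abs_self _
    rw [hs, div_mul_eq_mul_div, one_mul, div_le_div_iff₀ (by positivity) (by norm_num)]
    linarith
  -- at `u = - s τ` the inequality reads `0 ≤ 4 s² τ² (1 + e) - 2 s τ² (1 + s² τ²)`
  have h2 := key (-s * τ)
  have h3 : 0 ≤ (s * τ ^ 2) * (4 * (s * (1 + e)) - 2 * (1 + s ^ 2 * τ ^ 2)) := by
    linear_combination h2
  have h4 := nonneg_of_mul_nonneg_right h3 (by positivity)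
  have h5 : 0 ≤ s ^ 2 * τ ^ 2 := by positivity
  linarith

/-- Filtering by a maximizer `S₀` of `|det S|² / det Φ(S S†)` and by a square root of the inverse of
`Φ(S₀ S₀†)` makes `Φ` unital and the identity a maximizer. -/
theorem exists_normalForm_of_no_pure {Φ : QubitMap} (h : IsCompletelyPositive Φ)
    (hp : ∀ f : Fin 2 → ℂ, f ≠ 0 → (Φ (Matrix.vecMulVec f (star f))).det ≠ 0) :
    ∃ N, IsNormalForm N ∧ HasNormalForm Φ N := by
  have hpd : ∀ S : QubitOp, S ≠ 0 → (Φ (S * Sᴴ)).PosDef := fun S hS => posDef_map_of_no_pure h hp hS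
  obtain ⟨S₀, hS₀, hmax⟩ := exists_maximizer fun S hS =>
    (Complex.pos_iff.1 (hpd S hS).det_pos).1
  have hne : S₀ ≠ 0 := by
    rintro rfl
    simp at hS₀
  obtain ⟨C, hC⟩ : ∃ C : QubitOp, Φ (S₀ * S₀ᴴ) = Cᴴ * C := by
    open scoped MatrixOrder in
    exact CStarAlgebra.nonneg_iff_eq_star_mul_self.1 (hpd S₀ hne).posSemidef.nonneg
  have hdet : (Φ (S₀ * S₀ᴴ)).det = ((Complex.normSq C.det : ℝ) : ℂ) := by
    rw [hC, Matrix.det_mul, Matrix.det_conjTranspose, Complex.normSq_eq_conj_mul_self]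
    rfl
  have hCd : C.det ≠ 0 := by
    intro h0
    have := (hpd S₀ hne).det_pos
    rw [hdet, h0] at this
    simp at this
  have hCu : IsUnit C.det := hCd.isUnit
  have hCh : IsUnit Cᴴ.det := by
    rw [Matrix.det_conjTranspose]
    exact hCu.star
  set B : QubitOp := (Cᴴ)⁻¹ with hB
  have hBt : Bᴴ = C⁻¹ := by
    rw [hB, Matrix.conjTranspose_nonsing_inv, Matrix.conjTranspose_conjTranspose]
  have hBd : B.det * star C.det = 1 := by
    rw [← Matrix.det_conjTranspose, ← Matrix.det_mul, hB, Matrix.nonsing_inv_mul _ hCh,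
      Matrix.det_one]
  have hBd0 : B.det ≠ 0 := left_ne_zero_of_mul_eq_one hBd
  set Ω := filtered S₀ Φ B with hΩ
  have hΩcp : IsCompletelyPositive Ω := h.filtered _ _
  have hΩ1 : Ω 1 = 1 := by
    rw [hΩ, filtered_apply, Matrix.mul_one, hC, hBt, hB, ← Matrix.mul_assoc,
      Matrix.nonsing_inv_mul _ hCh, Matrix.one_mul, Matrix.mul_nonsing_inv _ hCu]
  have hΩd : ∀ S : QubitOp, Complex.normSq S.det ≤ (Ω (S * Sᴴ)).det.re := by
    intro S
    have h1 := hmax (S₀ * S)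
    rw [Matrix.det_mul, map_mul, hdet, Complex.ofReal_re] at h1
    have hn : Complex.normSq B.det * Complex.normSq C.det = 1 := by
      have := congrArg Complex.normSq hBd
      simpa [map_mul] using this
    have h2 : (Ω (S * Sᴴ)).det.re
        = Complex.normSq B.det * (Φ (S₀ * S * (S₀ * S)ᴴ)).det.re := by
      rw [hΩ, filtered_apply, Matrix.det_mul, Matrix.det_mul, Matrix.det_conjTranspose,
        mul_right_comm, ← Complex.re_ofReal_mul]
      congr 2
      · exact Complex.mul_conj _
      · simp only [Matrix.conjTranspose_mul, Matrix.mul_assoc]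
    rw [h2]
    have hS₀p := Complex.normSq_pos.2 hS₀
    have hBp := Complex.normSq_pos.2 hBd0
    have h3 : Complex.normSq S.det * Complex.normSq C.det
        ≤ (Φ (S₀ * S * (S₀ * S)ᴴ)).det.re :=
      le_of_mul_le_mul_left (by linarith) hS₀p
    calc Complex.normSq S.det
        = Complex.normSq B.det * (Complex.normSq S.det * Complex.normSq C.det) := by
          linear_combination -Complex.normSq S.det * hn
      _ ≤ _ := mul_le_mul_of_nonneg_left h3 hBp.le
  obtain ⟨R, hR⟩ := hΩcp.exists_real_rMatrix
  have hRe : ∀ i j, R i j = ((1 / 2 : ℂ) * (pauli i * Ω (pauli j)).trace).re := by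
    intro i j
    rw [← rMatrix_apply, hR, Matrix.map_apply, Complex.ofReal_re]
  have p0 : pauli 0 = 1 := by
    ext a b
    fin_cases a <;> fin_cases b <;> simp [pauli]
  have hcol : ∀ i, R i 0 = if i = 0 then 1 else 0 := by
    intro i
    have : (pauli i * pauli 0).trace = (pauli i).trace := by rw [p0, Matrix.mul_one]
    rw [hRe, p0, hΩ1, Matrix.mul_one, ← this, trace_pauli_mul_pauli]
    split_ifs <;> simp
  have hrow : ∀ j, j ≠ 0 → R 0 j = 0 := by
    intro j hj
    rw [hRe, p0, Matrix.one_mul, show (1 / 2 : ℂ) = ((1 / 2 : ℝ) : ℂ) by norm_num,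
      Complex.re_ofReal_mul, trace_map_pauli_eq_zero hΩ1 hΩd hj, mul_zero]
  have hblock : rMatrix Ω = ((1 : ℝ) • spatial (Matrix.of fun i j => R i.succ j.succ)).map
      Complex.ofReal := by
    rw [hR, one_smul]
    congr 1
    ext i j
    fin_cases i <;> fin_cases j <;> simp [spatial, hcol, hrow]
  obtain ⟨s₁, s₂, s₃, hs, hn⟩ := exists_diag_of_block hΩcp one_pos hblock
  exact ⟨_, Or.inl ⟨s₁, s₂, s₃, hs, rfl⟩, hn.of_filtered hS₀ hBd0⟩

/-! ### Existence and uniqueness of the normal form, and its consequences -/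

theorem IsQubitChannel.exists_normalForm {Φ : QubitMap} (hΦ : IsQubitChannel Φ) :
    ∃ N, IsNormalForm N ∧ HasNormalForm Φ N := by
  by_cases hp : ∀ f : Fin 2 → ℂ, f ≠ 0 → (Φ (Matrix.vecMulVec f (star f))).det ≠ 0
  · exact exists_normalForm_of_no_pure hΦ.1 hp
  · push Not at hp
    obtain ⟨f, hf, hd⟩ := hp
    exact exists_normalForm_of_pure hΦ hf hd

theorem IsNormalForm.nonDiag_bounds {x : ℝ} (h : IsNormalForm (nonDiagForm x)) :
    0 ≤ x ∧ x ≤ 1 := by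
  rcases h with ⟨s₁, s₂, s₃, -, h⟩ | ⟨y, h0, h1, h⟩ | h
  · have := congrFun (congrFun h 3) 0
    simp [nonDiagForm, diagForm] at this
  · have h2 : x / √3 = y / √3 := congrFun (congrFun h 1) 1
    rw [div_left_inj' (Real.sqrt_pos.2 (by norm_num)).ne'] at h2
    exact h2 ▸ ⟨h0, h1⟩
  · have := congrFun (congrFun h 3) 3
    simp [nonDiagForm, constForm] at this

theorem theorem8 (Φ : QubitMap) (hΦ : IsQubitChannel Φ) :
    -- exactly one of the normal forms
    (∃! N : Matrix (Fin 4) (Fin 4) ℝ, IsNormalForm N ∧ HasNormalForm Φ N) ∧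
    -- Kraus operators, normal form of the first kind
    (∀ s₁ s₂ s₃ : ℝ, DiagParams s₁ s₂ s₃ → HasNormalForm Φ (diagForm s₁ s₂ s₃) →
      ∃ (A B : QubitOp) (p : Fin 4 → ℝ), A.det ≠ 0 ∧ B.det ≠ 0 ∧ IsBellCoeff p s₁ s₂ s₃ ∧
        IsKrausFamily (diagKraus p A B) Φ) ∧
    -- Kraus operators, normal form of the second kind
    (∀ x : ℝ, 0 ≤ x → x ≤ 1 → HasNormalForm Φ (nonDiagForm x) →
      ∃ A B : QubitOp, A.det ≠ 0 ∧ B.det ≠ 0 ∧ IsKrausFamily (nonDiagKraus x A B) Φ) ∧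
    -- in the third case everything is mapped to the same point
    (HasNormalForm Φ constForm →
      ∃ τ : QubitOp, τ.PosSemidef ∧ τ.trace = 1 ∧ ∀ X : QubitOp, Φ X = X.trace • τ) ∧
    -- a Lorentz singular value decomposition exists, and each one yields all the data
    (∃ (c : ℝ) (L₁ N L₂ : Matrix (Fin 4) (Fin 4) ℝ), IsLorentzSVD Φ c L₁ N L₂) ∧
    (∀ (c : ℝ) (L₁ N L₂ : Matrix (Fin 4) (Fin 4) ℝ), IsLorentzSVD Φ c L₁ N L₂ →
      ∃ A B : Matrix.SpecialLinearGroup (Fin 2) ℂ,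
        lorentzOf A = L₂ ∧ lorentzOf B = L₁ ∧ HasNormalFormVia Φ N c A B ∧
        (∀ (s₁ s₂ s₃ : ℝ) (p : Fin 4 → ℝ), N = diagForm s₁ s₂ s₃ → IsBellCoeff p s₁ s₂ s₃ →
          IsKrausFamily (diagKraus p (((√c : ℝ) : ℂ) • B.val) A.val) Φ) ∧
        (∀ x : ℝ, N = nonDiagForm x →
          IsKrausFamily (nonDiagKraus x (((√c : ℝ) : ℂ) • B.val) A.val) Φ)) := by
  refine ⟨?_, ?_, ?_, fun h => h.eq_trace_smul hΦ.2, ?_, ?_⟩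
  · obtain ⟨N, hN, hf⟩ := hΦ.exists_normalForm
    exact ⟨N, ⟨hN, hf⟩, fun N' ⟨hN', hf'⟩ => HasNormalForm.unique hN hN' hf hf'⟩
  · rintro s₁ s₂ s₃ hs ⟨c, hc, A, B, h⟩
    obtain ⟨p, hp⟩ := hs.exists_isBellCoeff
    exact ⟨_, A.val, p, det_smul_specialLinear_ne_zero hc B, by simp [A.2], hp,
      h.isKrausFamily_diag hc.le hp⟩
  · rintro x hx0 hx1 ⟨c, hc, A, B, h⟩
    exact ⟨_, A.val, det_smul_specialLinear_ne_zero hc B, by simp [A.2],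
      h.isKrausFamily_nonDiag hc.le hx0 hx1⟩
  · obtain ⟨N, hN, c, hc, A, B, h⟩ := hΦ.exists_normalForm
    exact ⟨c, lorentzOf B, N, lorentzOf A, hc, isLorentz_lorentzOf B, hN, isLorentz_lorentzOf A,
      (hasNormalFormVia_iff _ _ _ _ _).1 h⟩
  · rintro c L₁ N L₂ ⟨hc, h1, hN, h2, hR⟩
    obtain ⟨A, rfl⟩ := exists_lorentzOf_eq h2
    obtain ⟨B, rfl⟩ := exists_lorentzOf_eq h1
    have h := (hasNormalFormVia_iff _ _ _ _ _).2 hR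
    refine ⟨A, B, rfl, rfl, h, ?_, ?_⟩
    · rintro s₁ s₂ s₃ p rfl hp
      exact h.isKrausFamily_diag hc.le hp
    · rintro x rfl
      obtain ⟨hx0, hx1⟩ := hN.nonDiag_bounds
      exact h.isKrausFamily_nonDiag hc.le hx0 hx1
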